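/- Let $k$ be a field. For $k$-algebras $A,B$ (viewed as dg categories with one object, concentrated in degree $0$) let $\mathcal D(A^{\mathrm{op}}\otimes_k B)$ be the derived category of $A$-$B$-bimodules, and let $\mathrm{rep}(A,B)\subset \mathcal D(A^{\mathrm{op}}\otimes_k B)$ be the full triangulated subcategory of those complexes of bimodules whose underlying complex of right $B$-modules is a compact object of $\mathcal D(B)$. Let $U(A)$ denote the noncommutative motive of $A$, i.e. $A$ regarded as an object of the additive category $\mathsf{Hmo}_0$ in which $\mathrm{Hom}(U(A),U(B))=K_0\,\mathrm{rep}(A,B)$, the composition is the biadditive law induced by the derived tensor product $(M,N)\mapsto M\otimes^{\mathbf L}_B N$, and the identity of $U(A)$ is the class of the $A$-$A$-bimodule $A$. **Proposition.** Let $n\ge 0$ and let $A_1,\dots,A_n$ be (finite-dimensional) central simple $k$-algebras. Then $$\bigoplus_{i=1}^n U(A_i)\;\simeq\;\bigoplus_{i=1}^n U(k)\quad\text{in }\mathsf{Hmo}_0$$ if and only if $[A_1]=\cdots=[A_n]=[k]$ in the Brauer group $\mathrm{Br}(k)$. -/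

import Mathlib

open CategoryTheory CategoryTheory.Limits
open scoped TensorProduct

universe u

namespace NCMotive

set_option linter.unusedSectionVars false

/-! ## Tensor products of bimodules

An `A`-`B`-bimodule is a left module over `A ⊗[k] Bᵐᵒᵖ`. -/

section BimoduleTensor

variable (k : Type u) [Field k] (A B C : Type u) [Ring A] [Algebra k A] [Ring B] [Algebra k B]
  [Ring C] [Algebra k C]
  (M : Type u) [AddCommGroup M] [Module k M] [Module (A ⊗[k] Bᵐᵒᵖ) M]
  [IsScalarTower k (A ⊗[k] Bᵐᵒᵖ) M]
  (N : Type u) [AddCommGroup N] [Module k N] [Module (B ⊗[k] Cᵐᵒᵖ) N]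
  [IsScalarTower k (B ⊗[k] Cᵐᵒᵖ) N]

/-- The relations `(m b) ⊗ n = m ⊗ (b n)` that cut out `M ⊗_B N` from `M ⊗_k N`. -/
def balancingRel : Submodule k (M ⊗[k] N) :=
  Submodule.span k {t | ∃ (m : M) (b : B) (n : N),
    t = (((1 : A) ⊗ₜ[k] MulOpposite.op b) • m) ⊗ₜ[k] n
      - m ⊗ₜ[k] ((b ⊗ₜ[k] (1 : Cᵐᵒᵖ)) • n)}

/-- The tensor product `M ⊗_B N` of an `A`-`B`-bimodule and a `B`-`C`-bimodule. -/
def BimodTensor : Type u := (M ⊗[k] N) ⧸ balancingRel k A B C M N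

noncomputable instance : AddCommGroup (BimodTensor k A B C M N) :=
  inferInstanceAs (AddCommGroup ((M ⊗[k] N) ⧸ balancingRel k A B C M N))

noncomputable instance : Module k (BimodTensor k A B C M N) :=
  inferInstanceAs (Module k ((M ⊗[k] N) ⧸ balancingRel k A B C M N))

variable {M N} in
/-- The pure tensor `m ⊗ n` in `M ⊗_B N`. -/
def BimodTensor.tmul (m : M) (n : N) : BimodTensor k A B C M N :=
  Submodule.Quotient.mk (m ⊗ₜ[k] n)

variable {M N} {M' N' : Type u} [AddCommGroup M'] [Module k M'] [Module (A ⊗[k] Bᵐᵒᵖ) M']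
  [IsScalarTower k (A ⊗[k] Bᵐᵒᵖ) M'] [AddCommGroup N'] [Module k N']
  [Module (B ⊗[k] Cᵐᵒᵖ) N'] [IsScalarTower k (B ⊗[k] Cᵐᵒᵖ) N']

/-- The map `f ⊗ g : M ⊗_B N → M' ⊗_B N'` for a right `B`-linear `f` and a left `B`-linear `g`. -/
noncomputable def BimodTensor.map (f : M →ₗ[k] M') (g : N →ₗ[k] N')
    (hf : ∀ (b : B) (m : M), f (((1 : A) ⊗ₜ[k] MulOpposite.op b) • m)
      = ((1 : A) ⊗ₜ[k] MulOpposite.op b) • f m)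
    (hg : ∀ (b : B) (n : N), g ((b ⊗ₜ[k] (1 : Cᵐᵒᵖ)) • n) = (b ⊗ₜ[k] (1 : Cᵐᵒᵖ)) • g n) :
    BimodTensor k A B C M N →ₗ[k] BimodTensor k A B C M' N' :=
  Submodule.mapQ _ _ (TensorProduct.map f g) (by
    rw [balancingRel, Submodule.span_le]
    rintro _ ⟨m, b, n, rfl⟩
    refine Submodule.subset_span ⟨f m, b, g n, ?_⟩
    rw [map_sub, TensorProduct.map_tmul, TensorProduct.map_tmul, hf, hg])

@[simp]
theorem BimodTensor.map_tmul (f : M →ₗ[k] M') (g : N →ₗ[k] N') (hf) (hg) (m : M) (n : N) :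
    BimodTensor.map k A B C f g hf hg (BimodTensor.tmul k A B C m n)
      = BimodTensor.tmul k A B C (f m) (g n) := rfl

variable {k A B C} in
theorem BimodTensor.induction_on {p : BimodTensor k A B C M N → Prop}
    (x : BimodTensor k A B C M N) (zero : p 0)
    (tmul : ∀ m n, p (BimodTensor.tmul k A B C m n))
    (add : ∀ x y, p x → p y → p (x + y)) : p x := by
  obtain ⟨t, rfl⟩ := Submodule.Quotient.mk_surjective (balancingRel k A B C M N) x
  induction t using TensorProduct.induction_on with
  | zero => exact zero
  | tmul m n => exact tmul m n
  | add x y hx hy => exact add _ _ hx hy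

variable {k A B C} in
theorem BimodTensor.hom_ext {P : Type u} [AddCommGroup P] [Module k P]
    {f g : BimodTensor k A B C M N →ₗ[k] P}
    (h : ∀ m n, f (BimodTensor.tmul k A B C m n) = g (BimodTensor.tmul k A B C m n)) : f = g := by
  ext x
  induction x using BimodTensor.induction_on with
  | zero => simp
  | tmul m n => exact h m n
  | add x y hx hy => rw [map_add, map_add, hx, hy]

theorem BimodTensor.tmul_add (m : M) (n n' : N) : BimodTensor.tmul k A B C m (n + n')
    = BimodTensor.tmul k A B C m n + BimodTensor.tmul k A B C m n' :=
  congrArg Submodule.Quotient.mk (TensorProduct.tmul_add m n n')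

theorem BimodTensor.add_tmul (m m' : M) (n : N) : BimodTensor.tmul k A B C (m + m') n
    = BimodTensor.tmul k A B C m n + BimodTensor.tmul k A B C m' n :=
  congrArg Submodule.Quotient.mk (TensorProduct.add_tmul m m' n)

variable (M N)

/-- The left action of `A` on `M ⊗_B N`, `a (m ⊗ n) = (a m) ⊗ n`. -/
noncomputable def BimodTensor.leftAction : A →ₐ[k] Module.End k (BimodTensor k A B C M N) :=
  AlgHom.ofLinearMap
    { toFun := fun a => BimodTensor.map k A B C
        (Algebra.lsmul k k M (a ⊗ₜ[k] (1 : Bᵐᵒᵖ))) LinearMap.id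
        (fun b m => by simp [smul_smul]) (fun _ _ => rfl)
      map_add' := fun a a' => BimodTensor.hom_ext fun m n => by
        simp [TensorProduct.add_tmul, BimodTensor.add_tmul]
      map_smul' := fun r a => BimodTensor.hom_ext fun m n => by
        simp only [← TensorProduct.smul_tmul', map_smul]
        rfl }
    (BimodTensor.hom_ext fun m n => by
      simp [← Algebra.TensorProduct.one_def])
    (fun a a' => BimodTensor.hom_ext fun m n => by
      simp [smul_smul])

/-- The right action of `C` on `M ⊗_B N`, `(m ⊗ n) c = m ⊗ (n c)`. -/
noncomputable def BimodTensor.rightAction : Cᵐᵒᵖ →ₐ[k] Module.End k (BimodTensor k A B C M N) :=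
  AlgHom.ofLinearMap
    { toFun := fun c => BimodTensor.map k A B C LinearMap.id
        (Algebra.lsmul k k N ((1 : B) ⊗ₜ[k] c))
        (fun _ _ => rfl) (fun b m => by simp [smul_smul])
      map_add' := fun a a' => BimodTensor.hom_ext fun m n => by
        simp [TensorProduct.tmul_add, BimodTensor.tmul_add]
      map_smul' := fun r a => BimodTensor.hom_ext fun m n => by
        simp only [TensorProduct.tmul_smul, map_smul]
        exact congrArg Submodule.Quotient.mk (TensorProduct.tmul_smul r m _) }
    (BimodTensor.hom_ext fun m n => by
      simp [← Algebra.TensorProduct.one_def])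
    (fun a a' => BimodTensor.hom_ext fun m n => by
      simp [smul_smul])

/-- The action of `A ⊗ Cᵐᵒᵖ` on `M ⊗_B N`. -/
noncomputable def BimodTensor.action :
    (A ⊗[k] Cᵐᵒᵖ) →ₐ[k] Module.End k (BimodTensor k A B C M N) :=
  Algebra.TensorProduct.lift (BimodTensor.leftAction k A B C M N)
    (BimodTensor.rightAction k A B C M N)
    (fun _ _ => BimodTensor.hom_ext fun _ _ => rfl)

/-- `M ⊗_B N` is an `A`-`C`-bimodule. -/
noncomputable instance : Module (A ⊗[k] Cᵐᵒᵖ) (BimodTensor k A B C M N) :=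
  Module.compHom _ (BimodTensor.action k A B C M N).toRingHom

variable {M N}

theorem BimodTensor.smul_tmul (a : A) (c : Cᵐᵒᵖ) (m : M) (n : N) :
    (a ⊗ₜ[k] c) • BimodTensor.tmul k A B C m n
      = BimodTensor.tmul k A B C ((a ⊗ₜ[k] (1 : Bᵐᵒᵖ)) • m) (((1 : B) ⊗ₜ[k] c) • n) := rfl

theorem BimodTensor.map_smul_bimod (f : M →ₗ[k] M') (g : N →ₗ[k] N') (hf) (hg)
    (hf' : ∀ (a : A) (m : M), f ((a ⊗ₜ[k] (1 : Bᵐᵒᵖ)) • m) = (a ⊗ₜ[k] (1 : Bᵐᵒᵖ)) • f m)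
    (hg' : ∀ (c : Cᵐᵒᵖ) (n : N), g (((1 : B) ⊗ₜ[k] c) • n) = ((1 : B) ⊗ₜ[k] c) • g n)
    (r : A ⊗[k] Cᵐᵒᵖ) (x : BimodTensor k A B C M N) :
    BimodTensor.map k A B C f g hf hg (r • x) = r • BimodTensor.map k A B C f g hf hg x := by
  induction r using TensorProduct.induction_on with
  | zero =>
    have h : (0 : A ⊗[k] Cᵐᵒᵖ) • x = 0 :=
      DFunLike.congr_fun (map_zero (BimodTensor.action k A B C M N)) x
    have h' (y : BimodTensor k A B C M' N') : (0 : A ⊗[k] Cᵐᵒᵖ) • y = 0 :=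
      DFunLike.congr_fun (map_zero (BimodTensor.action k A B C M' N')) y
    exact ((congrArg _ h).trans (map_zero _)).trans (h' _).symm
  | add r s hr hs => rw [add_smul, map_add, hr, hs, add_smul]
  | tmul a c =>
    induction x using BimodTensor.induction_on with
    | zero => rw [smul_zero, map_zero, smul_zero]
    | add x y hx hy => rw [smul_add, map_add, hx, hy, map_add, smul_add]
    | tmul m n =>
      rw [BimodTensor.smul_tmul, BimodTensor.map_tmul, BimodTensor.map_tmul, hf', hg',
        BimodTensor.smul_tmul]

/-- The map `f ⊗ g : M ⊗_B N → M' ⊗_B N'` of `A`-`C`-bimodules induced by maps of bimodules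
`f : M → M'` and `g : N → N'`. -/
noncomputable def BimodTensor.mapBimod (f : M →ₗ[A ⊗[k] Bᵐᵒᵖ] M') (g : N →ₗ[B ⊗[k] Cᵐᵒᵖ] N') :
    BimodTensor k A B C M N →ₗ[A ⊗[k] Cᵐᵒᵖ] BimodTensor k A B C M' N' where
  toFun := BimodTensor.map k A B C (f.restrictScalars k) (g.restrictScalars k)
    (fun b m => by simp) (fun b n => by simp)
  map_add' := map_add _
  map_smul' := fun r x => BimodTensor.map_smul_bimod k A B C _ _ _ _
    (fun a m => f.map_smul _ m) (fun c n => g.map_smul _ n) r x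

@[simp]
theorem BimodTensor.mapBimod_tmul (f : M →ₗ[A ⊗[k] Bᵐᵒᵖ] M') (g : N →ₗ[B ⊗[k] Cᵐᵒᵖ] N')
    (m : M) (n : N) : BimodTensor.mapBimod k A B C f g (BimodTensor.tmul k A B C m n)
      = BimodTensor.tmul k A B C (f m) (g n) := rfl

variable {k A B C} in
theorem BimodTensor.bimod_hom_ext {P : Type u} [AddCommGroup P] [Module (A ⊗[k] Cᵐᵒᵖ) P]
    {f g : BimodTensor k A B C M N →ₗ[A ⊗[k] Cᵐᵒᵖ] P}
    (h : ∀ m n, f (BimodTensor.tmul k A B C m n) = g (BimodTensor.tmul k A B C m n)) : f = g := by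
  ext x
  induction x using BimodTensor.induction_on with
  | zero => simp
  | tmul m n => exact h m n
  | add x y hx hy => rw [map_add, map_add, hx, hy]

end BimoduleTensor

/-! ## Categories of bimodules and of complexes of bimodules -/

section Bimodules

variable (k : Type u) [Field k] (A B C : Type u) [Ring A] [Algebra k A] [Ring B] [Algebra k B]
  [Ring C] [Algebra k C]

/-- The abelian category of `A`-`B`-bimodules. -/
abbrev Bimod : Type (u + 1) := ModuleCat.{u} (A ⊗[k] Bᵐᵒᵖ)

open scoped ModuleCat

/-- The bifunctor `(M, N) ↦ M ⊗_B N` on categories of bimodules. -/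
noncomputable def tensorFunctor : Bimod k A B ⥤ Bimod k B C ⥤ Bimod k A C where
  obj M :=
    { obj := fun N => ModuleCat.of _ (BimodTensor k A B C M N)
      map := fun g => ModuleCat.ofHom (BimodTensor.mapBimod k A B C LinearMap.id g.hom)
      map_id := fun _ => ModuleCat.hom_ext (BimodTensor.bimod_hom_ext fun _ _ => rfl)
      map_comp := fun _ _ => ModuleCat.hom_ext (BimodTensor.bimod_hom_ext fun _ _ => rfl) }
  map f :=
    { app := fun _ => ModuleCat.ofHom (BimodTensor.mapBimod k A B C f.hom LinearMap.id)
      naturality := fun _ _ _ => ModuleCat.hom_ext (BimodTensor.bimod_hom_ext fun _ _ => rfl) }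
  map_id _ := NatTrans.ext (funext fun _ =>
    ModuleCat.hom_ext (BimodTensor.bimod_hom_ext fun _ _ => rfl))
  map_comp _ _ := NatTrans.ext (funext fun _ =>
    ModuleCat.hom_ext (BimodTensor.bimod_hom_ext fun _ _ => rfl))

instance : (tensorFunctor k A B C).Additive where
  map_add {_ _ f g} := NatTrans.ext (funext fun _ =>
    ModuleCat.hom_ext (BimodTensor.bimod_hom_ext fun m n =>
      BimodTensor.add_tmul k A B C (f.hom m) (g.hom m) n))

instance (M : Bimod k A B) : ((tensorFunctor k A B C).obj M).Additive where
  map_add {_ _ f g} := ModuleCat.hom_ext (BimodTensor.bimod_hom_ext fun m n =>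
    BimodTensor.tmul_add k A B C m (f.hom n) (g.hom n))

variable {k A B C}

/-- The total tensor product `K ⊗_B L` of complexes of bimodules:
in degree `n` it is `⨁_{i + j = n} K^i ⊗_B L^j`, with `d (x ⊗ y) = dx ⊗ y + (-1)^i x ⊗ dy`. -/
noncomputable def tensorComplex (K : CochainComplex (Bimod k A B) ℤ)
    (L : CochainComplex (Bimod k B C) ℤ) : CochainComplex (Bimod k A C) ℤ :=
  CochainComplex.mapBifunctor K L (tensorFunctor k A B C)

end Bimodules

/-! ## Derived categories, compact objects and Grothendieck groups -/

attribute [local instance] HasDerivedCategory.standard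

section Triangulated

variable {D : Type*} [Category* D] [Preadditive D]

/-- An object `X` is compact if `Hom(X, -)` commutes with small coproducts, that is, if every
morphism from `X` to a (small) coproduct factors through a finite subcoproduct. (Injectivity of
`⨁ Hom(X, Y j) → Hom(X, ∐ Y j)` is automatic in a preadditive category.) -/
def IsCompactObj (X : D) : Prop :=
  ∀ ⦃J : Type u⦄ (Y : J → D) (c : Cofan Y), IsColimit c → ∀ f : X ⟶ c.pt,
    ∃ (s : Finset J) (g : ∀ j, X ⟶ Y j), f = ∑ j ∈ s, g j ≫ c.inj j

variable [HasZeroObject D] [HasShift D ℤ] [∀ n : ℤ, (shiftFunctor D n).Additive]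
  [Pretriangulated D]

/-- The relations `[X₂] = [X₁] + [X₃]`, one for each distinguished triangle
`X₁ ⟶ X₂ ⟶ X₃ ⟶ X₁⟦1⟧` all of whose objects satisfy `P`. -/
def triangleRel (P : ObjectProperty D) : AddSubgroup (FreeAbelianGroup {X : D // P X}) :=
  AddSubgroup.closure {x | ∃ (T : Pretriangulated.Triangle D) (h₁ : P T.obj₁) (h₂ : P T.obj₂)
    (h₃ : P T.obj₃), T ∈ Pretriangulated.distinguishedTriangles ∧
    x = FreeAbelianGroup.of ⟨T.obj₂, h₂⟩ - FreeAbelianGroup.of ⟨T.obj₁, h₁⟩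
      - FreeAbelianGroup.of ⟨T.obj₃, h₃⟩}

/-- The Grothendieck group `K₀` of the full triangulated subcategory of `D` whose objects
satisfy `P`. -/
abbrev K0 (P : ObjectProperty D) : Type _ := FreeAbelianGroup {X : D // P X} ⧸ triangleRel P

/-- The class `[X]` in `K₀`. -/
def K0.mk (P : ObjectProperty D) (X : D) (hX : P X) : K0 P :=
  QuotientAddGroup.mk (FreeAbelianGroup.of ⟨X, hX⟩)

end Triangulated

section Motives

variable (k : Type u) [Field k] (A B C : Type u) [Ring A] [Algebra k A] [Ring B] [Algebra k B]
  [Ring C] [Algebra k C]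

/-- The derived category `𝒟(Aᵒᵖ ⊗ B)` of `A`-`B`-bimodules. -/
abbrev DBimod : Type (u + 1) := DerivedCategory (Bimod k A B)

/-- The functor which sends an `A`-`B`-bimodule to its underlying right `B`-module. -/
noncomputable def forgetLeft : Bimod k A B ⥤ ModuleCat.{u} Bᵐᵒᵖ :=
  ModuleCat.restrictScalars
    (Algebra.TensorProduct.includeRight : Bᵐᵒᵖ →ₐ[k] A ⊗[k] Bᵐᵒᵖ).toRingHom

instance : (forgetLeft k A B).Additive :=
  inferInstanceAs (ModuleCat.restrictScalars _).Additive

theorem forgetLeft_exact (S : ShortComplex (Bimod k A B)) (h : S.Exact) :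
    (S.map (forgetLeft k A B)).Exact := by
  rw [ShortComplex.ShortExact.moduleCat_exact_iff_function_exact] at h ⊢
  exact h

instance : PreservesFiniteLimits (forgetLeft k A B) := by
  have h := ((Functor.exact_tfae (forgetLeft k A B)).out 1 3).mp (forgetLeft_exact k A B)
  exact h.1

instance : PreservesFiniteColimits (forgetLeft k A B) := by
  have h := ((Functor.exact_tfae (forgetLeft k A B)).out 1 3).mp (forgetLeft_exact k A B)
  exact h.2

/-- `rep(A, B) ⊆ 𝒟(Aᵒᵖ ⊗ B)`: the (complexes of) `A`-`B`-bimodules whose underlying complex of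
right `B`-modules is a compact object of `𝒟(B)`. -/
def rep : ObjectProperty (DBimod k A B) := fun X =>
  IsCompactObj.{u} ((forgetLeft k A B).mapDerivedCategory.obj X)

/-- `Hom(U(A), U(B)) = K₀ rep(A, B)`. -/
abbrev MotHom : Type (u + 1) := K0 (rep k A B)

/-- `A` regarded as an `A`-`A`-bimodule. -/
noncomputable def idBimod : Bimod k A A :=
  letI : Module (A ⊗[k] Aᵐᵒᵖ) A := TensorProduct.Algebra.module
  ModuleCat.of (A ⊗[k] Aᵐᵒᵖ) A

/-- `A` as an object of `𝒟(Aᵒᵖ ⊗ A)`, concentrated in degree zero. -/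
noncomputable def idObj : DBimod k A A :=
  (DerivedCategory.singleFunctor (Bimod k A A) 0).obj (idBimod k A)

variable {k A B C}

/-- `α` is the class `[X]` of the object `X` of `rep(A, B)`. -/
def IsClassOf (X : DBimod k A B) (α : MotHom k A B) : Prop :=
  ∃ hX : rep k A B X, α = K0.mk (rep k A B) X hX

/-- `P` is a derived tensor product `M ⊗ᴸ_B N`: it is represented by `K ⊗_B L`, where `K` is a
K-projective complex representing `M` and `L` is a complex representing `N`. (As `k` is a field,
a K-projective complex of `A`-`B`-bimodules is also K-flat over `B`.) -/
def IsDerivedTensor (M : DBimod k A B) (N : DBimod k B C) (P : DBimod k A C) : Prop :=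
  ∃ (K : CochainComplex (Bimod k A B) ℤ) (L : CochainComplex (Bimod k B C) ℤ),
    K.IsKProjective ∧ Nonempty (DerivedCategory.Q.obj K ≅ M) ∧
    Nonempty (DerivedCategory.Q.obj L ≅ N) ∧
    Nonempty (DerivedCategory.Q.obj (tensorComplex K L) ≅ P)

/-- The graph of the composition law
`K₀ rep(A, B) × K₀ rep(B, C) → K₀ rep(A, C)`, the biadditive map with `([M], [N]) ↦ [M ⊗ᴸ_B N]`:
`IsComp α β γ` says that the composite `U(A) ⟶ U(B) ⟶ U(C)` of `α` and `β` is `γ`. -/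
inductive IsComp : MotHom k A B → MotHom k B C → MotHom k A C → Prop
  | tensor {M : DBimod k A B} {N : DBimod k B C} {P : DBimod k A C} {α β γ}
      (h : IsDerivedTensor M N P) (hα : IsClassOf M α) (hβ : IsClassOf N β)
      (hγ : IsClassOf P γ) : IsComp α β γ
  | zero_left (β) : IsComp 0 β 0
  | zero_right (α) : IsComp α 0 0
  | add_left {α α' β γ γ'} : IsComp α β γ → IsComp α' β γ' → IsComp (α + α') β (γ + γ')
  | add_right {α β β' γ γ'} : IsComp α β γ → IsComp α β' γ' → IsComp α (β + β') (γ + γ')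
  | neg_left {α β γ} : IsComp α β γ → IsComp (-α) β (-γ)
  | neg_right {α β γ} : IsComp α β γ → IsComp α (-β) (-γ)

end Motives

/-! ## Noncommutative motives -/

section Additive

variable (k : Type u) [Field k]

/-- Finite formal direct sums `⨁ᵢ U(Aᵢ)` of noncommutative motives of `k`-algebras: an algebra is
a dg category with one object, and `U` is the identity on objects. -/
structure Motive where
  /-- the index set of the direct sum -/
  ι : Type
  [fintype : Fintype ι]
  /-- the algebras `Aᵢ` -/
  alg : ι → AlgCat.{u} k

attribute [instance] Motive.fintype

variable {k}

/-- The direct sum `⨁ᵢ U(Aᵢ)`. -/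
def sumU {ι : Type} [Fintype ι] (A : ι → AlgCat.{u} k) : Motive k := ⟨ι, A⟩

/-- A morphism `⨁ᵢ U(Aᵢ) ⟶ ⨁ⱼ U(Bⱼ)` in the additive category of noncommutative motives: a matrix
of morphisms `U(Aᵢ) ⟶ U(Bⱼ)`. -/
def Motive.Hom (X Y : Motive k) : Type (u + 1) :=
  ∀ (i : X.ι) (j : Y.ι), MotHom k (X.alg i) (Y.alg j)

/-- `h` is the composite of `f` and `g` (matrix multiplication). -/
def Motive.IsComp {X Y Z : Motive k} (f : X.Hom Y) (g : Y.Hom Z) (h : X.Hom Z) : Prop :=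
  ∀ (i : X.ι) (l : Z.ι), ∃ t : Y.ι → MotHom k (X.alg i) (Z.alg l),
    (∀ j, NCMotive.IsComp (f i j) (g j l) (t j)) ∧ h i l = ∑ j, t j

/-- `h` is the identity of `X`: the diagonal entries are the classes of the bimodules `Aᵢ`, and
the other entries vanish. -/
def Motive.IsId {X : Motive k} (h : X.Hom X) : Prop :=
  (∀ i, IsClassOf (idObj k (X.alg i)) (h i i)) ∧ ∀ i j, i ≠ j → h i j = 0

/-- `X` and `Y` are isomorphic noncommutative motives. -/
def Motive.Isomorphic (X Y : Motive k) : Prop :=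
  ∃ (f : X.Hom Y) (g : Y.Hom X) (e : X.Hom X) (e' : Y.Hom Y),
    Motive.IsId e ∧ Motive.IsId e' ∧ Motive.IsComp f g e ∧ Motive.IsComp g f e'

variable (k)

/-- `k` as a central simple `k`-algebra. -/
noncomputable def baseCSA : CSA.{u, u} k := { AlgCat.of k k with
  isCentral := inferInstanceAs (Algebra.IsCentral k k)
  isSimple := inferInstanceAs (IsSimpleRing k)
  fin_dim := inferInstanceAs (FiniteDimensional k k) }

variable {k}

/-- The class of a central simple algebra in the Brauer group. -/
def brauerClass (A : CSA.{u, u} k) : BrauerGroup.{u, u} k := Quotient.mk (Brauer.CSA_Setoid k) A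

end Additive

end NCMotive

/-! The proof rests on one invariant, the Euler characteristic χ(X) = ∑ (-1)^n dim_k Hⁿ(X). If B is
finite-dimensional and semisimple, compactness over B forces finite-dimensional total cohomology
(`finiteTotalCohomology_of_rep`), and the long exact sequence makes χ additive on triangles, so χ is
defined on K₀ rep(A, B). By Künneth, composition through the motive of k multiplies Euler
characteristics (`IsComp.eulerChar_mul`).

Write A = M_r(D) with D a division algebra and d = dim_k D. An A-k-bimodule is an A-module, hence of
the form W^r for a D-vector space W, so rd divides its dimension. The same holds for k-A-bimodules,
with D replaced by its opposite. An isomorphism of motives writes the identity of U(A) as a sum of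
composites U(A) → U(k) → U(A). Therefore (rd)² divides χ(A) = dim_k A = r²d, which forces d = 1: A
is a matrix algebra over k, that is, its Brauer class is trivial (`finrank_eq_one_of_isComp`,
`brauerClass_eq_baseCSA_iff`).

Conversely, M_r(k) is Morita equivalent to k: column and row vectors are mutually inverse bimodules,
and they give inverse isomorphisms of motives (`exists_inverse_of_matrix`).

Homological algebra stays elementary because modules over a semisimple ring form a category in which
every morphism has a generalized inverse. There each complex is homotopy equivalent to its
cohomology (`exists_homotopyEquiv_zero_d`) and is K-projective, so morphisms in the derived category
are homotopy classes of chain maps. -/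

namespace NCMotive

attribute [local instance] HasDerivedCategory.standard

/-! ### Complexes over regular abelian categories -/

/-- Every morphism of the category has a generalized inverse. For an abelian category this says
that every short exact sequence splits. -/
class VonNeumannRegular (C : Type*) [Category* C] : Prop where
  exists_quasiInverse {X Y : C} (f : X ⟶ Y) : ∃ g : Y ⟶ X, f ≫ g ≫ f = f

theorem exists_section_of_epi {C : Type*} [Category* C] [VonNeumannRegular C] {X Y : C}
    (f : X ⟶ Y) [Epi f] : ∃ g : Y ⟶ X, g ≫ f = 𝟙 Y := by
  obtain ⟨g, hg⟩ := VonNeumannRegular.exists_quasiInverse f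
  exact ⟨g, by rw [← cancel_epi f, hg, Category.comp_id]⟩

/-- Split the surjection of X onto the range of f, then extend that section from the range to all of
Y. -/
instance (R : Type*) [Ring R] [IsSemisimpleRing R] : VonNeumannRegular (ModuleCat.{u} R) where
  exists_quasiInverse {X Y} f := by
    obtain ⟨s, hs⟩ := IsSemisimpleModule.lifting_property f.hom.rangeRestrict
      f.hom.surjective_rangeRestrict LinearMap.id
    obtain ⟨g, hg⟩ := IsSemisimpleModule.extension_property (LinearMap.range f.hom).subtype
      (Submodule.injective_subtype _) s
    refine ⟨ModuleCat.ofHom g, ?_⟩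
    ext x
    have h1 : g (f.hom x) = s ⟨f.hom x, x, rfl⟩ := LinearMap.congr_fun hg ⟨f.hom x, x, rfl⟩
    have h2 := congrArg Subtype.val (LinearMap.congr_fun hs ⟨f.hom x, x, rfl⟩)
    simpa [h1] using h2

section Complexes

variable {C : Type*} [Category* C] [Abelian C] [VonNeumannRegular C]

/-- Over a category all of whose morphisms are regular, a complex is homotopy equivalent to a
complex with zero differential. -/
theorem exists_homotopyEquiv_zero_d (K : CochainComplex C ℤ) :
    ∃ H : CochainComplex C ℤ, (∀ i j, H.d i j = 0) ∧ Nonempty (HomotopyEquiv K H) := by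
  choose g hg using fun i j => VonNeumannRegular.exists_quasiInverse (K.d i j)
  -- The correction factor `𝟙 - d ≫ g` does not change `d ≫ h`, but it kills the cross term `d ≫ g ≫
  -- g ≫ d` that would keep `d ≫ h + h ≫ d` from being idempotent.
  let h : ∀ i j, K.X i ⟶ K.X j := fun i j =>
    if j + 1 = i then (𝟙 _ - K.d i (i + 1) ≫ g i (i + 1)) ≫ g j i else 0
  have hh (j : ℤ) : h (j + 1) j
      = (𝟙 _ - K.d (j + 1) (j + 1 + 1) ≫ g (j + 1) (j + 1 + 1)) ≫ g j (j + 1) := if_pos rfl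
  have hd (n : ℤ) : K.d n (n + 1) ≫ h (n + 1) n = K.d n (n + 1) ≫ g n (n + 1) := by
    simp [hh, Preadditive.sub_comp, Preadditive.comp_sub]
  have hdd (n : ℤ) : K.d n (n + 1) ≫ h (n + 1) n ≫ K.d n (n + 1) = K.d n (n + 1) := by
    rw [← Category.assoc, hd, Category.assoc, hg]
  have hhd (n : ℤ) : K.d (n + 1) (n + 1 + 1) ≫ h (n + 1 + 1) (n + 1) ≫ h (n + 1) n = 0 := by
    rw [← Category.assoc, hd, hh, ← Category.assoc, Preadditive.comp_sub, Category.comp_id,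
      Category.assoc, reassoc_of% hg (n + 1) (n + 1 + 1), sub_self, zero_comp]
  let h₀ : ∀ i j, (ComplexShape.up ℤ).Rel j i → (K.X i ⟶ K.X j) := fun i j _ => h i j
  let p : K ⟶ K := Homotopy.nullHomotopicMap' h₀
  have hp (n : ℤ) : p.f (n + 1) = K.d (n + 1) (n + 1 + 1) ≫ h (n + 1 + 1) (n + 1)
      + h (n + 1) n ≫ K.d n (n + 1) :=
    Homotopy.nullHomotopicMap'_f (c := ComplexShape.up ℤ) (k₂ := n) (k₁ := n + 1) (k₀ := n + 1 + 1)
      rfl rfl h₀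
  have hpd (n : ℤ) : p.f (n + 1) ≫ K.d (n + 1) (n + 1 + 1) = K.d (n + 1) (n + 1 + 1) := by
    rw [hp, Preadditive.add_comp, Category.assoc, Category.assoc, K.d_comp_d, comp_zero, add_zero,
      hdd]
  have hpp : p ≫ p = p := by
    ext m
    obtain ⟨n, rfl⟩ : ∃ n, m = n + 1 := ⟨m - 1, by ring⟩
    rw [HomologicalComplex.comp_f]
    nth_rw 2 [hp]
    rw [Preadditive.comp_add, reassoc_of% hpd n]
    rw [hp, Preadditive.add_comp, Category.assoc, Category.assoc, reassoc_of% hhd n, zero_comp,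
      zero_add, hdd]
  -- The idempotent `𝟙 - p` is homotopic to the identity, since `p` is null-homotopic, and its image
  -- has zero differential because `p ≫ d = d`.
  obtain ⟨H, i, e, hie, hei⟩ := IsIdempotentComplete.idempotents_split K (𝟙 K - p) (by
    simp [Preadditive.sub_comp, Preadditive.comp_sub, hpp])
  refine ⟨H, fun a b => ?_, ⟨⟨e, i, ?_, Homotopy.ofEq hie⟩⟩⟩
  · by_cases hab : (ComplexShape.up ℤ).Rel a b
    · obtain rfl : a + 1 = b := hab
      obtain ⟨n, rfl⟩ : ∃ n, a = n + 1 := ⟨a - 1, by ring⟩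
      have h1 : i ≫ (𝟙 K - p) = i := by rw [← hei, reassoc_of% hie]
      have h2 : i.f (n + 1) ≫ K.d (n + 1) (n + 1 + 1) = 0 := by
        rw [← h1, HomologicalComplex.comp_f, HomologicalComplex.sub_f_apply,
          HomologicalComplex.id_f, Category.assoc, Preadditive.sub_comp, hpd, Category.id_comp,
          sub_self, comp_zero]
      have h3 : (i.f (n + 1 + 1)) ≫ e.f (n + 1 + 1) = 𝟙 _ := by
        rw [← HomologicalComplex.comp_f, hie, HomologicalComplex.id_f]
      rw [← Category.comp_id (H.d _ _), ← h3, ← Category.assoc, ← i.comm, h2, zero_comp]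
    · exact H.shape _ _ hab
  · rw [hei]
    exact ((Homotopy.equivSubZero.symm ((Homotopy.ofEq (by abel)).trans
      (Homotopy.nullHomotopy' h₀) : Homotopy (𝟙 K - (𝟙 K - p)) 0))).symm

/-- The model with zero differential is its own cohomology, so for an acyclic complex it is zero. -/
theorem acyclic_homotopy_id_zero (L : CochainComplex C ℤ) (hL : L.Acyclic) :
    Nonempty (Homotopy (𝟙 L) 0) := by
  obtain ⟨H, hH, ⟨e⟩⟩ := exists_homotopyEquiv_zero_d L
  have hz : ∀ n, IsZero (H.X n) := fun n => by
    have h1 : H.ExactAt n := by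
      rw [HomologicalComplex.exactAt_iff_isZero_homology]
      exact IsZero.of_iso ((HomologicalComplex.exactAt_iff_isZero_homology _ _).1 (hL n))
        (e.toHomologyIso n).symm
    rw [HomologicalComplex.exactAt_iff] at h1
    exact h1.isZero_X₂ (hH _ _) (hH _ _)
  have h0 : 𝟙 H = 0 := by
    ext n
    exact (hz n).eq_of_src _ _
  exact ⟨(e.homotopyHomInvId.symm.trans (Homotopy.ofEq (by
    rw [← Category.id_comp e.inv, h0, zero_comp, comp_zero])))⟩

instance isKProjective (K : CochainComplex C ℤ) : K.IsKProjective where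
  nonempty_homotopy_zero {L} f hL := by
    obtain ⟨h⟩ := acyclic_homotopy_id_zero L hL
    exact ⟨(Homotopy.ofEq (Category.comp_id f).symm).trans
      ((h.compLeft f).trans (Homotopy.ofEq comp_zero))⟩

end Complexes

/-! ### Morphisms and coproducts in the derived category -/

section Coproducts

variable {C : Type*} [Category* C] [Abelian C] 

/-- All complexes are K-projective, so passing from the homotopy category to the derived category is
fully faithful. This gives fullness on chain maps; `Q_map_injective` gives faithfulness up to
homotopy. -/
theorem Q_map_surjective [VonNeumannRegular C] {K L : CochainComplex C ℤ} (φ : DerivedCategory.Q.obj K ⟶ DerivedCategory.Q.obj L) :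
    ∃ f : K ⟶ L, DerivedCategory.Q.map f = φ := by
  obtain ⟨g, hg⟩ := (CochainComplex.IsKProjective.Qh_map_bijective K
    ((HomotopyCategory.quotient _ _).obj L)).surjective
    ((DerivedCategory.quotientCompQhIso C).hom.app K ≫ φ ≫
      (DerivedCategory.quotientCompQhIso C).inv.app L)
  obtain ⟨f, rfl⟩ := (HomotopyCategory.quotient _ _).map_surjective g
  refine ⟨f, ?_⟩
  have := DerivedCategory.quotientCompQhIso_hom_naturality f
  rw [← cancel_epi ((DerivedCategory.quotientCompQhIso C).hom.app K), ← this, hg]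
  simp

theorem Q_map_injective [VonNeumannRegular C] {K L : CochainComplex C ℤ} {f g : K ⟶ L}
    (h : DerivedCategory.Q.map f = DerivedCategory.Q.map g) : Nonempty (Homotopy f g) := by
  refine ⟨HomotopyCategory.homotopyOfEq _ _
    ((CochainComplex.IsKProjective.Qh_map_bijective K
    ((HomotopyCategory.quotient _ _).obj L)).injective ?_)⟩
  have h1 := DerivedCategory.quotientCompQhIso_hom_naturality f
  have h2 := DerivedCategory.quotientCompQhIso_hom_naturality g
  rw [← cancel_mono ((DerivedCategory.quotientCompQhIso C).hom.app L), h1, h2, h]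

end Coproducts

section Coproducts

variable {C : Type*} [Category* C] [Abelian C] {J : Type*}
  {L : J → CochainComplex C ℤ}

/-- Two maps out of a coproduct of complexes are homotopic if their restrictions to all summands
are. -/
theorem homotopy_of_cofan [HasColimitsOfShape (Discrete J) C] {c : Cofan L} (hc : IsColimit c) {Z : CochainComplex C ℤ}
    (f g : c.pt ⟶ Z) (h : ∀ j, Homotopy (c.inj j ≫ f) (c.inj j ≫ g)) : Nonempty (Homotopy f g) := by
  -- Coproducts of complexes are computed degreewise, so the components of the given homotopies glue
  -- in each degree.
  have hcn (n : ℤ) : IsColimit (Cofan.mk (c.pt.X n) fun j => (c.inj j).f n) :=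
    isColimitCofanMkObjOfIsColimit (HomologicalComplex.eval C _ n) L (fun j => c.inj j)
      (hc.ofIsoColimit (Cofan.ext (Iso.refl _) (by simp)))
  let hom (i j : ℤ) : c.pt.X i ⟶ Z.X j := Cofan.IsColimit.desc (hcn i) fun a => (h a).hom i j
  have fac (i j : ℤ) (a : J) : (c.inj a).f i ≫ hom i j = (h a).hom i j :=
    Cofan.IsColimit.fac (hcn i) _ a
  refine ⟨{ hom := hom, zero := fun i j hij => ?_, comm := fun i => ?_ }⟩
  · refine Cofan.IsColimit.hom_ext (hcn i) _ _ fun a => ?_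
    exact (fac i j a).trans (((h a).zero i j hij).trans comp_zero.symm)
  · refine Cofan.IsColimit.hom_ext (hcn i) _ _ fun a => ?_
    refine ((h a).comm i).trans ?_
    simp only [dNext, prevD, AddMonoidHom.mk'_apply, Preadditive.comp_add, Cofan.inj,
      Cofan.mk_ι_app, HomologicalComplex.comp_f]
    congr 2
    · refine (congrArg _ (fac _ _ a).symm).trans ?_
      exact ((c.inj a).comm_assoc _ _ _).symm
    · exact ((Category.assoc _ _ _).symm.trans (congrArg (· ≫ _) (fac _ _ a))).symm

variable [VonNeumannRegular C]

/-- Represent the target by a complex and each morphism by a chain map, then glue the chain maps. -/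
theorem exists_Q_desc {c : Cofan L} (hc : IsColimit c) {Y : DerivedCategory C}
    (g : ∀ j, DerivedCategory.Q.obj (L j) ⟶ Y) :
    ∃ φ : DerivedCategory.Q.obj c.pt ⟶ Y, ∀ j, DerivedCategory.Q.map (c.inj j) ≫ φ = g j := by
  let e := DerivedCategory.Q.objObjPreimageIso Y
  choose f hf using fun j => Q_map_surjective (g j ≫ e.inv)
  refine ⟨DerivedCategory.Q.map (Cofan.IsColimit.desc hc f) ≫ e.hom, fun j => ?_⟩
  rw [← Functor.map_comp_assoc, Cofan.IsColimit.fac, hf, Category.assoc, e.inv_hom_id,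
    Category.comp_id]

/-- The localization functor preserves coproducts. -/
theorem nonempty_isColimit_Q [HasColimitsOfShape (Discrete J) C] {c : Cofan L} (hc : IsColimit c) :
    Nonempty (IsColimit (Cofan.mk (DerivedCategory.Q.obj c.pt)
      fun j => DerivedCategory.Q.map (c.inj j))) := by
  choose d hd using fun t : Cofan fun j => DerivedCategory.Q.obj (L j) => exists_Q_desc hc t.inj
  refine ⟨Cofan.IsColimit.mk _ d hd fun t m hm => ?_⟩
  let e := DerivedCategory.Q.objObjPreimageIso t.pt
  obtain ⟨f, hf⟩ := Q_map_surjective (m ≫ e.inv)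
  obtain ⟨g, hg⟩ := Q_map_surjective (d t ≫ e.inv)
  have key : ∀ j, DerivedCategory.Q.map (c.inj j ≫ f) = DerivedCategory.Q.map (c.inj j ≫ g) :=
    fun j => by
      rw [Functor.map_comp, Functor.map_comp, hf, hg, ← Category.assoc, ← Category.assoc]
      exact congrArg (· ≫ _) ((hm j).trans (hd t j).symm)
  -- Uniqueness: chain maps that agree in the derived category on every summand are homotopic there,
  -- and the chosen homotopies glue.
  obtain ⟨h⟩ := homotopy_of_cofan hc f g fun j => (Q_map_injective (key j)).some
  rw [← cancel_mono e.inv, ← hf, ← hg, DerivedCategory.Q_map_eq_of_homotopy _ h]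

end Coproducts

theorem IsCompactObj.of_iso {D : Type*} [Category* D] [Preadditive D] {X X' : D} (e : X ≅ X')
    (h : IsCompactObj.{u} X) : IsCompactObj.{u} X' := fun J Y c hc f => by
  obtain ⟨s, g, hg⟩ := h Y c hc (e.hom ≫ f)
  refine ⟨s, fun j => e.inv ≫ g j, ?_⟩
  rw [← cancel_epi e.hom, hg, Preadditive.comp_sum]
  simp

/-! ### Compact complexes over a semisimple ring -/

section Modules

variable {R : Type u} [Ring R]

/-- A complex of modules has finite cohomology if its total cohomology is finitely generated. -/
def HasFiniteCohomology (X : DerivedCategory (ModuleCat.{u} R)) : Prop :=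
  (∀ n, Module.Finite R ((DerivedCategory.homologyFunctor (ModuleCat.{u} R) n).obj X)) ∧
    {n | ¬ IsZero ((DerivedCategory.homologyFunctor (ModuleCat.{u} R) n).obj X)}.Finite

/-- The identity factors through a finite product of the `N j`, so M is a quotient of that product.
-/
theorem moduleFinite_of_id_eq_sum {J : Type*} (s : Finset J) {M : ModuleCat.{u} R}
    (N : J → ModuleCat.{u} R) (hN : ∀ j, Module.Finite R (N j)) (a : ∀ j, M ⟶ N j)
    (b : ∀ j, N j ⟶ M) (h : 𝟙 M = ∑ j ∈ s, a j ≫ b j) : Module.Finite R M := by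
  classical
  refine Module.Finite.of_surjective
    (∑ j : s, (b j).hom ∘ₗ LinearMap.proj j : (∀ j : s, N j) →ₗ[R] M) fun m => ?_
  refine ⟨fun j => (a j).hom m, ?_⟩
  have := congrArg (fun f => f.hom m) h
  simp only [ModuleCat.hom_sum, LinearMap.sum_apply] at this ⊢
  rw [← Finset.sum_coe_sort] at this
  exact this.symm

theorem isZero_homology_Q_single (M : ModuleCat.{u} R) {i n : ℤ} (h : n ≠ i) :
    IsZero ((DerivedCategory.homologyFunctor (ModuleCat.{u} R) n).obj
      (DerivedCategory.Q.obj ((HomologicalComplex.single (ModuleCat.{u} R) (ComplexShape.up ℤ) i).obj M))) :=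
  IsZero.of_iso (HomologicalComplex.isZero_single_obj_homology (ComplexShape.up ℤ) i M n h)
    ((DerivedCategory.homologyFunctorFactors (ModuleCat.{u} R) n).app _)

theorem homology_Q_single_finite (M : ModuleCat.{u} R) [Module.Finite R M] (i n : ℤ) :
    Module.Finite R ((DerivedCategory.homologyFunctor (ModuleCat.{u} R) n).obj
      (DerivedCategory.Q.obj ((HomologicalComplex.single (ModuleCat.{u} R) (ComplexShape.up ℤ) i).obj M))) := by
  by_cases h : n = i
  · subst h
    let e := (DerivedCategory.homologyFunctorFactors (ModuleCat.{u} R) n).app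
      ((HomologicalComplex.single (ModuleCat.{u} R) (ComplexShape.up ℤ) n).obj M) ≪≫
        HomologicalComplex.singleObjHomologySelfIso (ComplexShape.up ℤ) n M
    exact Module.Finite.equiv e.symm.toLinearEquiv
  · have := ModuleCat.subsingleton_of_isZero (isZero_homology_Q_single M h)
    exact ⟨⟨∅, Subsingleton.elim _ _⟩⟩

variable [IsSemisimpleRing R]

/-- Up to isomorphism X is a retract of a coproduct of shifted copies of R. By compactness the
section lands in a finite subcoproduct, so the identity of X factors through finitely many shifts of
R. -/
theorem IsCompactObj.hasFiniteCohomology {X : DerivedCategory (ModuleCat.{u} R)}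
    (hX : IsCompactObj.{u} X) : HasFiniteCohomology X := by
  classical
  obtain ⟨H, hH, ⟨he⟩⟩ := exists_homotopyEquiv_zero_d (DerivedCategory.Q.objPreimage X)
  let e : X ≅ DerivedCategory.Q.obj H := (DerivedCategory.Q.objObjPreimageIso X).symm ≪≫
    ⟨DerivedCategory.Q.map he.hom, DerivedCategory.Q.map he.inv, by
      rw [← Functor.map_comp, DerivedCategory.Q_map_eq_of_homotopy _ he.homotopyHomInvId,
        CategoryTheory.Functor.map_id], by
      rw [← Functor.map_comp, DerivedCategory.Q_map_eq_of_homotopy _ he.homotopyInvHomId,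
        CategoryTheory.Functor.map_id]⟩
  -- One shifted copy of R for each element in each degree, so that the map to H is trivially
  -- surjective.
  let J : Type u := Σ n : ℤ, H.X n
  let L : J → CochainComplex (ModuleCat.{u} R) ℤ := fun j =>
    (HomologicalComplex.single (ModuleCat.{u} R) (ComplexShape.up ℤ) j.1).obj (ModuleCat.of R R)
  let p (j : J) : L j ⟶ H := HomologicalComplex.mkHomFromSingle
    (ModuleCat.ofHom (LinearMap.toSpanSingleton R (H.X j.1) j.2)) (fun k _ => by rw [hH, comp_zero])
  let c : Cofan L := Cofan.mk (∐ L) (Sigma.ι L)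
  have hc : IsColimit c := coproductIsCoproduct L
  let φ : c.pt ⟶ H := Sigma.desc p
  have hφ (j : J) : c.inj j ≫ φ = p j := colimit.ι_desc _ _
  have hepi (n : ℤ) : Epi (φ.f n) := by
    rw [ModuleCat.epi_iff_surjective]
    intro x
    refine ⟨(c.inj ⟨n, x⟩).f n
      ((HomologicalComplex.singleObjXSelf (ComplexShape.up ℤ) n (ModuleCat.of R R)).inv (1 : R)), ?_⟩
    have h1 : (c.inj ⟨n, x⟩).f n ≫ φ.f n
        = (HomologicalComplex.singleObjXSelf (ComplexShape.up ℤ) n (ModuleCat.of R R)).hom ≫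
          ModuleCat.ofHom (LinearMap.toSpanSingleton R (H.X n) x) := by
      rw [← HomologicalComplex.comp_f, hφ]
      exact HomologicalComplex.mkHomFromSingle_f _ _
    rw [← ModuleCat.comp_apply, ← ModuleCat.comp_apply, h1, Iso.inv_hom_id_assoc]
    exact one_smul R x
  have hcd (i j : ℤ) : c.pt.d i j = 0 := by
    have hcn : IsColimit (Cofan.mk (c.pt.X i) fun j => (c.inj j).f i) :=
      isColimitCofanMkObjOfIsColimit (HomologicalComplex.eval _ _ i) L (fun j => c.inj j)
        (hc.ofIsoColimit (Cofan.ext (Iso.refl _) (by simp)))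
    refine Cofan.IsColimit.hom_ext hcn _ _ fun a => ?_
    refine ((c.inj a).comm i j).trans ?_
    rw [HomologicalComplex.single_obj_d, zero_comp, comp_zero]
  choose σ hσ using fun n => exists_section_of_epi (φ.f n)
  -- Sections chosen independently in each degree form a chain map because both differentials
  -- vanish.
  let ψ : H ⟶ c.pt := { f := σ, comm' := fun i j _ => by rw [hcd, hH, comp_zero, zero_comp] }
  have hψ : ψ ≫ φ = 𝟙 H := by
    ext1 n
    exact hσ n
  obtain ⟨s, g, hg⟩ := hX.of_iso e _ _ (nonempty_isColimit_Q hc).some (DerivedCategory.Q.map ψ)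
  have hid : 𝟙 (DerivedCategory.Q.obj H) = ∑ j ∈ s, g j ≫ DerivedCategory.Q.map (p j) := by
    rw [← CategoryTheory.Functor.map_id, ← hψ, Functor.map_comp, hg, Preadditive.sum_comp]
    refine Finset.sum_congr rfl fun j _ => ?_
    rw [Category.assoc, ← hφ, Functor.map_comp]
    rfl
  have hid' (n : ℤ) : 𝟙 ((DerivedCategory.homologyFunctor (ModuleCat.{u} R) n).obj (DerivedCategory.Q.obj H)) =
      ∑ j ∈ s, (DerivedCategory.homologyFunctor (ModuleCat.{u} R) n).map (g j) ≫
        (DerivedCategory.homologyFunctor (ModuleCat.{u} R) n).map (DerivedCategory.Q.map (p j)) := by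
    rw [← CategoryTheory.Functor.map_id, hid, Functor.map_sum]
    simp
  refine ⟨fun n => ?_, ?_⟩
  · have h1 := moduleFinite_of_id_eq_sum s _
      (fun j => homology_Q_single_finite (ModuleCat.of R R) j.1 n) _ _ (hid' n)
    exact Module.Finite.equiv ((DerivedCategory.homologyFunctor (ModuleCat.{u} R) n).mapIso e).symm.toLinearEquiv
  · refine (s.image Sigma.fst).finite_toSet.subset fun n hn => ?_
    by_contra hns
    refine hn (IsZero.of_iso ?_ ((DerivedCategory.homologyFunctor (ModuleCat.{u} R) n).mapIso e))
    rw [IsZero.iff_id_eq_zero, hid' n]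
    refine Finset.sum_eq_zero fun j hj => ?_
    have hne : n ≠ j.1 := fun h => hns (by
      rw [h]
      exact Finset.mem_coe.2 (Finset.mem_image_of_mem _ hj))
    rw [(isZero_homology_Q_single (ModuleCat.of R R) hne).eq_of_tgt
      ((DerivedCategory.homologyFunctor (ModuleCat.{u} R) n).map (g j)) 0, zero_comp]

/-- Compare the given coproduct with the termwise coproduct of representing complexes, of which it
is a retract. A chain map from M is determined by finitely many generators, whose images have only
finitely many nonzero components. -/
theorem isCompactObj_Q_single (M : ModuleCat.{u} R) [hM : Module.Finite R M] (i : ℤ) :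
    IsCompactObj.{u} (DerivedCategory.Q.obj
      ((HomologicalComplex.single (ModuleCat.{u} R) (ComplexShape.up ℤ) i).obj M)) := by
  classical
  intro J Y c hc f
  let L : J → CochainComplex (ModuleCat.{u} R) ℤ := fun j => DerivedCategory.Q.objPreimage (Y j)
  let e (j : J) : DerivedCategory.Q.obj (L j) ≅ Y j := DerivedCategory.Q.objObjPreimageIso (Y j)
  let d : Cofan L := Cofan.mk (∐ L) (Sigma.ι L)
  have hd : IsColimit d := coproductIsCoproduct L
  obtain ⟨ψ, hψ⟩ := exists_Q_desc hd (fun j => (e j).hom ≫ c.inj j)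
  let φ : c.pt ⟶ DerivedCategory.Q.obj d.pt :=
    Cofan.IsColimit.desc hc fun j => (e j).inv ≫ DerivedCategory.Q.map (d.inj j)
  have hφψ : φ ≫ ψ = 𝟙 _ := Cofan.IsColimit.hom_ext hc _ _ fun j => by
    rw [Cofan.IsColimit.fac_assoc, Category.assoc, hψ, Iso.inv_hom_id_assoc, Category.comp_id]
  obtain ⟨g, hg⟩ := Q_map_surjective (f ≫ φ)
  let π (j : J) : d.pt ⟶ L j :=
    Cofan.IsColimit.desc hd fun j' => if h : j' = j then eqToHom (congrArg L h) else 0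
  have hπ (j : J) : d.inj j ≫ π j = 𝟙 _ := by simp [π]
  have hπ' {j j' : J} (h : j' ≠ j) : d.inj j' ≫ π j = 0 := by simp [π, h]
  -- Elements that are the sum of their components over some finite set. Demanding this for every
  -- larger finite set makes closure under addition immediate.
  let N : Submodule R (d.pt.X i) :=
    { carrier := {x | ∃ s : Finset J, ∀ t, s ⊆ t → x = ∑ j ∈ t, ((π j ≫ d.inj j).f i).hom x}
      add_mem' := by
        rintro x y ⟨s, hs⟩ ⟨t, ht⟩
        refine ⟨s ∪ t, fun r hr => ?_⟩
        simp only [map_add, Finset.sum_add_distrib]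
        rw [← hs r (Finset.union_subset_left hr), ← ht r (Finset.union_subset_right hr)]
      zero_mem' := ⟨∅, fun t _ => by simp⟩
      smul_mem' := by
        rintro r x ⟨s, hs⟩
        refine ⟨s, fun t ht => ?_⟩
        simp only [map_smul, ← Finset.smul_sum]
        rw [← hs t ht] }
  have hN (j : J) (y : (L j).X i) : ((d.inj j).f i).hom y ∈ N := by
    refine ⟨{j}, fun t ht => ?_⟩
    have h1 (j' : J) : ((π j' ≫ d.inj j').f i).hom (((d.inj j).f i).hom y)
        = ((d.inj j ≫ π j' ≫ d.inj j').f i).hom y := rfl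
    rw [Finset.sum_eq_single j]
    · rw [h1, reassoc_of% hπ j]
    · intro j' _ hne
      rw [h1, reassoc_of% hπ' hne.symm, zero_comp]
      rfl
    · exact fun h => absurd (ht (Finset.mem_singleton_self j)) h
  have hdn : IsColimit (Cofan.mk (d.pt.X i) fun j => (d.inj j).f i) :=
    isColimitCofanMkObjOfIsColimit (HomologicalComplex.eval _ _ i) L (fun j => d.inj j)
      (hd.ofIsoColimit (Cofan.ext (Iso.refl _) (by simp)))
  have hNtop : ∀ x, x ∈ N := by
    have h0 : ModuleCat.ofHom N.mkQ = 0 := Cofan.IsColimit.hom_ext hdn _ _ fun j => by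
      ext y
      exact (Submodule.Quotient.mk_eq_zero N).2 (hN j y)
    intro x
    rw [← Submodule.Quotient.mk_eq_zero N]
    exact congrArg (fun f => f.hom x) h0
  choose s hs using hNtop
  let ι := HomologicalComplex.singleObjXSelf (ComplexShape.up ℤ) i M
  let g₀ : M ⟶ d.pt.X i := ι.inv ≫ g.f i
  obtain ⟨G, hG⟩ := hM.fg_top
  let S : Finset J := G.biUnion fun m => s (g₀.hom m)
  have hgS : g = ∑ j ∈ S, (g ≫ π j) ≫ d.inj j := by
    apply HomologicalComplex.from_single_hom_ext
    rw [← cancel_epi ι.inv]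
    have : g₀.hom = ∑ j ∈ S, ((π j ≫ d.inj j).f i).hom ∘ₗ g₀.hom := by
      refine LinearMap.ext_on hG fun m hm => ?_
      rw [LinearMap.sum_apply]
      exact hs _ S (Finset.subset_biUnion_of_mem (fun m => s (g₀.hom m)) hm)
    refine ModuleCat.hom_ext (this.trans ?_)
    have h1 : (∑ j ∈ S, (g ≫ π j) ≫ d.inj j).f i = ∑ j ∈ S, ((g ≫ π j) ≫ d.inj j).f i :=
      (HomologicalComplex.eval (ModuleCat.{u} R) _ i).map_sum _ S
    rw [h1, Preadditive.comp_sum, ModuleCat.hom_sum]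
    rfl
  refine ⟨S, fun j => DerivedCategory.Q.map (g ≫ π j) ≫ (e j).hom, ?_⟩
  rw [← Category.comp_id f, ← hφψ, ← Category.assoc, ← hg, hgS, Functor.map_sum,
    Preadditive.sum_comp]
  refine Finset.sum_congr rfl fun j _ => ?_
  rw [Functor.map_comp, Category.assoc, hψ, ← hgS, Category.assoc]

end Modules

/-! ### Euler characteristics -/

section EulerCharacteristic

open scoped ModuleCat

variable (k : Type u) [Field k] {R : Type u} [Ring R] [Algebra k R]

theorem finrank_eq_of_moduleCat_iso {M N : ModuleCat.{u} R} (e : M ≅ N) :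
    Module.finrank k M = Module.finrank k N :=
  (e.toLinearEquiv.restrictScalars k).finrank_eq

/-- The dimension over `k` of the `n`-th cohomology of a complex of modules. -/
noncomputable def cohomDim (X : DerivedCategory (ModuleCat.{u} R)) (n : ℤ) : ℕ :=
  Module.finrank k ((DerivedCategory.homologyFunctor (ModuleCat.{u} R) n).obj X)

/-- The Euler characteristic, over `k`, of a complex of modules. -/
noncomputable def eulerChar (X : DerivedCategory (ModuleCat.{u} R)) : ℤ :=
  ∑ᶠ n : ℤ, (n.negOnePow : ℤ) * (cohomDim k X n : ℤ)

/-- The total cohomology of a complex of modules is finite-dimensional over `k`. -/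
def FiniteTotalCohomology (X : DerivedCategory (ModuleCat.{u} R)) : Prop :=
  (∀ n, Module.Finite k ((DerivedCategory.homologyFunctor (ModuleCat.{u} R) n).obj X)) ∧
    (Function.support (cohomDim k X)).Finite

variable {k} in
theorem cohomDim_of_iso {X Y : DerivedCategory (ModuleCat.{u} R)} (e : X ≅ Y) :
    cohomDim k X = cohomDim k Y := funext fun n =>
  finrank_eq_of_moduleCat_iso k ((DerivedCategory.homologyFunctor (ModuleCat.{u} R) n).mapIso e)

variable {k} in
theorem eulerChar_of_iso {X Y : DerivedCategory (ModuleCat.{u} R)} (e : X ≅ Y) :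
    eulerChar k X = eulerChar k Y := by
  rw [eulerChar, eulerChar, cohomDim_of_iso e]

theorem cohomDim_Q (K : CochainComplex (ModuleCat.{u} R) ℤ) (n : ℤ) :
    cohomDim k (DerivedCategory.Q.obj K) n = Module.finrank k (K.homology n) :=
  finrank_eq_of_moduleCat_iso k
    ((DerivedCategory.homologyFunctorFactors (ModuleCat.{u} R) n).app K)

theorem cohomDim_Q_of_zero_d (K : CochainComplex (ModuleCat.{u} R) ℤ) (hK : ∀ i j, K.d i j = 0)
    (n : ℤ) : cohomDim k (DerivedCategory.Q.obj K) n = Module.finrank k (K.X n) :=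
  (cohomDim_Q k K n).trans (finrank_eq_of_moduleCat_iso k
    (ShortComplex.HomologyData.ofZeros (K.sc n) (hK _ _) (hK _ _)).left.homologyIso)

theorem eulerChar_Q_single (M : ModuleCat.{u} R) (i : ℤ) :
    eulerChar k (DerivedCategory.Q.obj
      ((HomologicalComplex.single (ModuleCat.{u} R) (ComplexShape.up ℤ) i).obj M))
      = (i.negOnePow : ℤ) * Module.finrank k M := by
  rw [eulerChar, finsum_eq_single _ i]
  · rw [cohomDim_Q]
    congr 2
    exact finrank_eq_of_moduleCat_iso k
      (HomologicalComplex.singleObjHomologySelfIso (ComplexShape.up ℤ) i M)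
  · intro n hn
    have := ModuleCat.subsingleton_of_isZero (isZero_homology_Q_single M hn)
    rw [cohomDim, Module.finrank_zero_of_subsingleton, Nat.cast_zero, mul_zero]

/-- Divisibility holds term by term. It survives without finiteness, since `finrank` and `finsum`
then default to 0. -/
theorem dvd_eulerChar {s : ℕ} (hs : ∀ M : ModuleCat.{u} R, s ∣ Module.finrank k M)
    (X : DerivedCategory (ModuleCat.{u} R)) : (s : ℤ) ∣ eulerChar k X :=
  finsum_induction (p := fun x => (s : ℤ) ∣ x) (dvd_zero _) (fun _ _ => dvd_add)
    fun _ => Dvd.dvd.mul_left (Int.natCast_dvd_natCast.2 (hs _)) _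

theorem finrank_eq_of_exact (S : ShortComplex (ModuleCat.{u} R)) (hS : S.Exact)
    [Module.Finite k S.X₂] : Module.finrank k S.X₂
      = Module.finrank k (LinearMap.range (S.f.hom.restrictScalars k))
        + Module.finrank k (LinearMap.range (S.g.hom.restrictScalars k)) := by
  rw [ShortComplex.ShortExact.moduleCat_exact_iff_function_exact] at hS
  have h : LinearMap.ker (S.g.hom.restrictScalars k)
      = LinearMap.range (S.f.hom.restrictScalars k) := by
    ext x
    exact hS x
  rw [← (S.g.hom.restrictScalars k).finrank_range_add_finrank_ker, h, add_comm]

/-- Each cohomology dimension is a sum of two consecutive ranks in the long exact sequence. In the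
alternating sum the ranks of the connecting maps cancel, as these maps raise the degree by one. -/
theorem eulerChar_triangle {T : Pretriangulated.Triangle (DerivedCategory (ModuleCat.{u} R))}
    (hT : T ∈ Pretriangulated.distinguishedTriangles) (h₁ : FiniteTotalCohomology k T.obj₁)
    (h₂ : FiniteTotalCohomology k T.obj₂) (h₃ : FiniteTotalCohomology k T.obj₃) :
    eulerChar k T.obj₂ = eulerChar k T.obj₁ + eulerChar k T.obj₃ := by
  let H (n : ℤ) := DerivedCategory.homologyFunctor (ModuleCat.{u} R) n
  let a (n : ℤ) : ℕ := Module.finrank k (LinearMap.range (((H n).map T.mor₁).hom.restrictScalars k))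
  let b (n : ℤ) : ℕ := Module.finrank k (LinearMap.range (((H n).map T.mor₂).hom.restrictScalars k))
  let c (n : ℤ) : ℕ := Module.finrank k (LinearMap.range
    ((DerivedCategory.HomologySequence.δ T n (n + 1) rfl).hom.restrictScalars k))
  have e₂ (n : ℤ) : cohomDim k T.obj₂ n = a n + b n :=
    have := h₂.1 n
    finrank_eq_of_exact k _ (DerivedCategory.HomologySequence.exact₂ T hT n)
  have e₃ (n : ℤ) : cohomDim k T.obj₃ n = b n + c n :=
    have := h₃.1 n
    finrank_eq_of_exact k _ (DerivedCategory.HomologySequence.exact₃ T hT n (n + 1) rfl)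
  have e₁ (n : ℤ) : cohomDim k T.obj₁ (n + 1) = c n + a (n + 1) :=
    have := h₁.1 (n + 1)
    finrank_eq_of_exact k _ (DerivedCategory.HomologySequence.exact₁ T hT n (n + 1) rfl)
  have fin {x : ℤ → ℕ} (hx : x.support.Finite) :
      (Function.support fun n : ℤ => (n.negOnePow : ℤ) * (x n : ℤ)).Finite :=
    hx.subset fun n hn h => hn (by simp [h])
  have ha : a.support.Finite := h₂.2.subset fun n hn h => hn (by have := e₂ n; simp_all)
  have hb : b.support.Finite := h₂.2.subset fun n hn h => hn (by have := e₂ n; simp_all)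
  have hc : c.support.Finite := h₃.2.subset fun n hn h => hn (by have := e₃ n; simp_all)
  have s₂ : eulerChar k T.obj₂ = (∑ᶠ n : ℤ, (n.negOnePow : ℤ) * (a n : ℤ))
      + ∑ᶠ n : ℤ, (n.negOnePow : ℤ) * (b n : ℤ) := by
    rw [← finsum_add_distrib (fin ha) (fin hb)]
    exact finsum_congr fun n => by rw [e₂]; push_cast; ring
  have s₃ : eulerChar k T.obj₃ = (∑ᶠ n : ℤ, (n.negOnePow : ℤ) * (b n : ℤ))
      + ∑ᶠ n : ℤ, (n.negOnePow : ℤ) * (c n : ℤ) := by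
    rw [← finsum_add_distrib (fin hb) (fin hc)]
    exact finsum_congr fun n => by rw [e₃]; push_cast; ring
  have s₁ : eulerChar k T.obj₁ = (∑ᶠ n : ℤ, (n.negOnePow : ℤ) * (a n : ℤ))
      - ∑ᶠ n : ℤ, (n.negOnePow : ℤ) * (c n : ℤ) := by
    -- The relation `e₁` lives in degree n + 1; reindexing the sum reverses the sign of `c n`.
    have shift (f : ℤ → ℤ) : ∑ᶠ n, f n = ∑ᶠ n, f (n + 1) :=
      (finsum_comp_equiv (Equiv.addRight (1 : ℤ))).symm
    rw [eulerChar, shift, shift fun n => (n.negOnePow : ℤ) * (a n : ℤ), ← finsum_sub_distrib]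
    · exact finsum_congr fun n => by rw [e₁, Int.negOnePow_succ]; push_cast; ring
    · exact (fin ha).preimage (add_left_injective (1 : ℤ)).injOn
    · exact fin hc
  rw [s₁, s₂, s₃]
  ring

/-- The Euler characteristic on the Grothendieck group of a category of complexes with
finite-dimensional total cohomology. -/
noncomputable def K0.eulerChar {P : ObjectProperty (DerivedCategory (ModuleCat.{u} R))}
    (hP : ∀ X, P X → FiniteTotalCohomology k X) : K0 P →+ ℤ :=
  QuotientAddGroup.lift _ (FreeAbelianGroup.lift fun X : {X // P X} => NCMotive.eulerChar k X.1) (by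
    rw [triangleRel, AddSubgroup.closure_le]
    rintro _ ⟨T, h₁, h₂, h₃, hT, rfl⟩
    simp [AddMonoidHom.mem_ker, eulerChar_triangle k hT (hP _ h₁) (hP _ h₂) (hP _ h₃)])

@[simp]
theorem K0.eulerChar_mk {P : ObjectProperty (DerivedCategory (ModuleCat.{u} R))}
    (hP : ∀ X, P X → FiniteTotalCohomology k X) (X : DerivedCategory (ModuleCat.{u} R))
    (hX : P X) : K0.eulerChar k hP (K0.mk P X hX) = NCMotive.eulerChar k X :=
  FreeAbelianGroup.lift_apply_of _ _

theorem K0.dvd_eulerChar {P : ObjectProperty (DerivedCategory (ModuleCat.{u} R))}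
    (hP : ∀ X, P X → FiniteTotalCohomology k X) {s : ℕ}
    (hs : ∀ M : ModuleCat.{u} R, s ∣ Module.finrank k M) (α : K0 P) :
    (s : ℤ) ∣ K0.eulerChar k hP α := by
  obtain ⟨x, rfl⟩ := QuotientAddGroup.mk_surjective α
  induction x using FreeAbelianGroup.induction_on with
  | zero => exact dvd_zero _ 
  | of X =>
    exact (K0.eulerChar_mk k hP X.1 X.2).symm ▸ NCMotive.dvd_eulerChar k hs X.1
  | neg X h =>
    rw [QuotientAddGroup.mk_neg, map_neg]
    exact h.neg_right
  | add x y hx hy =>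
    rw [QuotientAddGroup.mk_add, map_add]
    exact dvd_add hx hy

end EulerCharacteristic

/-! ### Finiteness of cohomology for objects of rep(A, B) -/

section Rep

open scoped ModuleCat

variable (k : Type u) [Field k] (A B : Type u) [Ring A] [Algebra k A] [Ring B] [Algebra k B]

/-- The underlying right module of the cohomology of a complex of bimodules. -/
noncomputable def forgetLeftHomologyIso (X : DBimod k A B) (n : ℤ) :
    (DerivedCategory.homologyFunctor (ModuleCat.{u} Bᵐᵒᵖ) n).obj
        ((forgetLeft k A B).mapDerivedCategory.obj X) ≅
      (forgetLeft k A B).obj ((DerivedCategory.homologyFunctor (Bimod k A B) n).obj X) :=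
  let K := DerivedCategory.Q.objPreimage X
  let e : DerivedCategory.Q.obj K ≅ X := DerivedCategory.Q.objObjPreimageIso X
  (DerivedCategory.homologyFunctor (ModuleCat.{u} Bᵐᵒᵖ) n).mapIso
      ((forgetLeft k A B).mapDerivedCategory.mapIso e.symm ≪≫
        (forgetLeft k A B).mapDerivedCategoryFactors.app K) ≪≫
    (DerivedCategory.homologyFunctorFactors (ModuleCat.{u} Bᵐᵒᵖ) n).app _ ≪≫
    (K.sc n).mapHomologyIso (forgetLeft k A B) ≪≫
    (forgetLeft k A B).mapIso
      (((DerivedCategory.homologyFunctorFactors (Bimod k A B) n).app K).symm ≪≫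
        (DerivedCategory.homologyFunctor (Bimod k A B) n).mapIso e)

/-- The underlying vector space of a bimodule is that of its underlying right module. -/
noncomputable def forgetLeftLinearEquiv (M : Bimod k A B) : ((forgetLeft k A B).obj M) ≃ₗ[k] M :=
  { AddEquiv.refl M with
    map_smul' := fun r x => by
      have h : (1 : A) ⊗ₜ[k] (algebraMap k Bᵐᵒᵖ r) = algebraMap k (A ⊗[k] Bᵐᵒᵖ) r := by
        rw [Algebra.algebraMap_eq_smul_one (R := k) (A := Bᵐᵒᵖ), TensorProduct.tmul_smul,
          Algebra.algebraMap_eq_smul_one (R := k) (A := A ⊗[k] Bᵐᵒᵖ)]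
        rfl
      exact congrArg (fun t : A ⊗[k] Bᵐᵒᵖ => t • (show M from x)) h }

theorem finite_of_forgetLeft [Module.Finite k B] (M : Bimod k A B)
    (h : Module.Finite Bᵐᵒᵖ ((forgetLeft k A B).obj M)) : Module.Finite k M := by
  have : Module.Finite k Bᵐᵒᵖ := Module.Finite.equiv (MulOpposite.opLinearEquiv k)
  have : Module.Finite k ((forgetLeft k A B).obj M) := Module.Finite.trans Bᵐᵒᵖ _
  exact Module.Finite.equiv (forgetLeftLinearEquiv k A B M)

-- Restriction to right B-modules is exact and keeps the underlying vector space, so finiteness can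
-- be tested there. Semisimplicity is required of B only.
variable {A B} in
theorem finiteTotalCohomology_of_rep [Module.Finite k B] [IsSemisimpleRing B] (X : DBimod k A B)
    (hX : rep k A B X) : FiniteTotalCohomology k X := by
  obtain ⟨h₁, h₂⟩ := IsCompactObj.hasFiniteCohomology hX
  refine ⟨fun n => ?_, h₂.subset fun n hn hz => hn ?_⟩
  · have := h₁ n
    exact finite_of_forgetLeft k A B _
      (Module.Finite.equiv (forgetLeftHomologyIso k A B X n).toLinearEquiv)
  · have h0 := ModuleCat.subsingleton_of_isZero (hz.of_iso (forgetLeftHomologyIso k A B X n).symm)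
    have : Subsingleton ((DerivedCategory.homologyFunctor (Bimod k A B) n).obj X) := h0
    exact Module.finrank_zero_of_subsingleton

/-- The Euler characteristic on `K₀ rep(A, B)`. -/
noncomputable def MotHom.eulerChar [Module.Finite k B] [IsSemisimpleRing B] : MotHom k A B →+ ℤ :=
  K0.eulerChar k (finiteTotalCohomology_of_rep k)

variable {A B} in
theorem rep_Q_single [IsSemisimpleRing B] (M : Bimod k A B)
    (h : Module.Finite Bᵐᵒᵖ ((forgetLeft k A B).obj M)) :
    rep k A B ((DerivedCategory.singleFunctor (Bimod k A B) 0).obj M) :=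
  (isCompactObj_Q_single ((forgetLeft k A B).obj M) 0).of_iso
    ((forgetLeft k A B).mapDerivedCategorySingleFunctor 0 |>.app M).symm

end Rep

/-! ### Total complexes of bifunctors -/

section Bifunctor

variable {C₁ C₂ D : Type*} [Category* C₁] [Category* C₂] [Category* D] [Abelian C₁] [Abelian C₂]
  [Abelian D] (F : C₁ ⥤ C₂ ⥤ D) [F.Additive] [∀ X, (F.obj X).Additive]
  [∀ (K : CochainComplex C₁ ℤ) (L : CochainComplex C₂ ℤ), CochainComplex.HasMapBifunctor K L F]

open HomologicalComplex in
theorem Q_mapBifunctor_iso {K K' : CochainComplex C₁ ℤ} {L L' : CochainComplex C₂ ℤ}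
    (e : HomotopyEquiv K K') (e' : HomotopyEquiv L L') :
    Nonempty (DerivedCategory.Q.obj (CochainComplex.mapBifunctor K L F) ≅
      DerivedCategory.Q.obj (CochainComplex.mapBifunctor K' L' F)) := by
  have key {K K' : CochainComplex C₁ ℤ} {L L' : CochainComplex C₂ ℤ}
      (e : HomotopyEquiv K K') (e' : HomotopyEquiv L L') :
      DerivedCategory.Q.map (mapBifunctorMap e.hom e'.hom F (ComplexShape.up ℤ)) ≫
        DerivedCategory.Q.map (mapBifunctorMap e.inv e'.inv F (ComplexShape.up ℤ)) = 𝟙 _ := by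
    have h1 : mapBifunctorMap e.hom e'.hom F (ComplexShape.up ℤ) ≫
        mapBifunctorMap e.inv e'.inv F (ComplexShape.up ℤ) =
        mapBifunctorMap (e.hom ≫ e.inv) (e'.hom ≫ e'.inv) F (ComplexShape.up ℤ) := by
      ext n i j h
      simp
    have h2 : mapBifunctorMap (𝟙 K) (𝟙 L) F (ComplexShape.up ℤ) = 𝟙 _ := by
      ext n i j h
      simp
    rw [← Functor.map_comp, h1,
      DerivedCategory.Q_map_eq_of_homotopy _
        (mapBifunctorMapHomotopy₁ e.homotopyHomInvId (e'.hom ≫ e'.inv) F (ComplexShape.up ℤ)),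
      DerivedCategory.Q_map_eq_of_homotopy _
        (mapBifunctorMapHomotopy₂ (𝟙 K) e'.homotopyHomInvId F (ComplexShape.up ℤ)), h2,
      CategoryTheory.Functor.map_id]
  exact ⟨⟨_, _, key e e', key e.symm e'.symm⟩⟩

theorem mapBifunctor_d_eq_zero {K : CochainComplex C₁ ℤ} {L : CochainComplex C₂ ℤ}
    (hK : ∀ i j, K.d i j = 0) (hL : ∀ i j, L.d i j = 0) (m n : ℤ) :
    (CochainComplex.mapBifunctor K L F).d m n = 0 := by
  by_cases hmn : (ComplexShape.up ℤ).Rel m n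
  · refine HomologicalComplex.mapBifunctor.hom_ext fun i j h => ?_
    rw [HomologicalComplex.mapBifunctor.d_eq, Preadditive.comp_add,
      HomologicalComplex.mapBifunctor.ι_D₁, HomologicalComplex.mapBifunctor.ι_D₂,
      HomologicalComplex.mapBifunctor.d₁_eq' K L F _ (i₁ := i) (i₁' := i + 1) rfl,
      HomologicalComplex.mapBifunctor.d₂_eq' K L F _ i (i₂ := j) (i₂' := j + 1) rfl, hK, hL]
    simp
  · exact HomologicalComplex.shape _ _ _ hmn

open HomologicalComplex in
/-- A bifunctor sends two single complexes to a single complex. -/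
theorem mapBifunctor_single (M : C₁) (N : C₂) :
    Nonempty ((single D (ComplexShape.up ℤ) 0).obj ((F.obj M).obj N) ≅
      CochainComplex.mapBifunctor ((single C₁ (ComplexShape.up ℤ) 0).obj M)
        ((single C₂ (ComplexShape.up ℤ) 0).obj N) F) := by
  let K := (single C₁ (ComplexShape.up ℤ) 0).obj M
  let L := (single C₂ (ComplexShape.up ℤ) 0).obj N
  let T := CochainComplex.mapBifunctor K L F
  -- Only bidegree (0, 0) survives, so its inclusion into the total complex is invertible in degree
  -- 0 and all other degrees vanish.
  have hz {i j : ℤ} (h : ¬ (i = 0 ∧ j = 0)) : IsZero ((F.obj (K.X i)).obj (L.X j)) := by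
    rw [IsZero.iff_id_eq_zero]
    by_cases hi : i = 0
    · have hj : j ≠ 0 := fun hj => h ⟨hi, hj⟩
      rw [← CategoryTheory.Functor.map_id,
        (isZero_single_obj_X (ComplexShape.up ℤ) 0 N j hj).eq_of_src (𝟙 _) 0, Functor.map_zero]
    · rw [← NatTrans.id_app, ← CategoryTheory.Functor.map_id,
        (isZero_single_obj_X (ComplexShape.up ℤ) 0 M i hi).eq_of_src (𝟙 _) 0, Functor.map_zero]
      rfl
  let a : (F.obj M).obj N ≅ (F.obj (K.X 0)).obj (L.X 0) :=
    (F.mapIso (singleObjXSelf (ComplexShape.up ℤ) 0 M).symm).app N ≪≫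
      (F.obj (K.X 0)).mapIso (singleObjXSelf (ComplexShape.up ℤ) 0 N).symm
  let ι : (F.obj (K.X 0)).obj (L.X 0) ⟶ T.X 0 := CochainComplex.ιMapBifunctor K L F 0 0 0 rfl
  let p : T.X 0 ⟶ (F.obj (K.X 0)).obj (L.X 0) := mapBifunctorDesc fun i j _ =>
    if h : i = 0 ∧ j = 0 then eqToHom (by rw [h.1, h.2]) else 0
  have hιp : ι ≫ p = 𝟙 _ := (ι_mapBifunctorDesc _ 0 0 rfl).trans (by simp)
  have hpι : p ≫ ι = 𝟙 _ := by
    refine mapBifunctor.hom_ext fun i j h => ?_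
    by_cases hij : i = 0 ∧ j = 0
    · obtain ⟨rfl, rfl⟩ := hij
      exact (Category.assoc _ _ _).symm.trans ((congrArg (· ≫ ι) hιp).trans
        ((Category.id_comp _).trans (Category.comp_id _).symm))
    · exact (hz hij).eq_of_src _ _
  have : IsIso ι := ⟨p, hιp, hpι⟩
  let φ : (single D (ComplexShape.up ℤ) 0).obj ((F.obj M).obj N) ⟶ T :=
    mkHomFromSingle (a.hom ≫ ι) fun n _ => by
      rw [mapBifunctor_d_eq_zero F (fun _ _ => single_obj_d _ _ _ _ _)
        (fun _ _ => single_obj_d _ _ _ _ _), comp_zero]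
  have hφ (n : ℤ) : IsIso (φ.f n) := by
    by_cases hn : n = 0
    · subst hn
      rw [show φ.f 0 = _ from mkHomFromSingle_f _ _]
      infer_instance
    · have h1 : IsZero (T.X n) := by
        rw [IsZero.iff_id_eq_zero]
        refine mapBifunctor.hom_ext fun i j h => (hz ?_).eq_of_src _ _
        rintro ⟨rfl, rfl⟩
        exact hn h.symm
      exact ⟨0, (isZero_single_obj_X (ComplexShape.up ℤ) 0 _ n hn).eq_of_src _ _, h1.eq_of_src _ _⟩
  have := Hom.isIso_of_components φ
  exact ⟨asIso φ⟩

end Bifunctor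

/-! ### Künneth over the base field -/

section Tensor

open scoped ModuleCat

variable (k : Type u) [Field k] {A B C : Type u} [Ring A] [Algebra k A] [Ring B] [Algebra k B]
  [Ring C] [Algebra k C]

/-- Elements of B are scalars, and scalars already move across a tensor product over k. -/
theorem balancingRel_eq_bot (hB : Function.Surjective (algebraMap k B))
    (M : Type u) [AddCommGroup M] [Module k M] [Module (A ⊗[k] Bᵐᵒᵖ) M]
    [IsScalarTower k (A ⊗[k] Bᵐᵒᵖ) M]
    (N : Type u) [AddCommGroup N] [Module k N] [Module (B ⊗[k] Cᵐᵒᵖ) N]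
    [IsScalarTower k (B ⊗[k] Cᵐᵒᵖ) N] : balancingRel k A B C M N = ⊥ := by
  rw [balancingRel, Submodule.span_eq_bot]
  rintro _ ⟨m, b, n, rfl⟩
  obtain ⟨r, rfl⟩ := hB b
  have h1 : (1 : A) ⊗ₜ[k] MulOpposite.op (algebraMap k B r) = r • (1 : A ⊗[k] Bᵐᵒᵖ) := by
    rw [Algebra.algebraMap_eq_smul_one, MulOpposite.op_smul, TensorProduct.tmul_smul]
    rfl
  have h2 : (algebraMap k B r) ⊗ₜ[k] (1 : Cᵐᵒᵖ) = r • (1 : B ⊗[k] Cᵐᵒᵖ) := by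
    rw [Algebra.algebraMap_eq_smul_one, ← TensorProduct.smul_tmul']
    rfl
  rw [h1, h2, smul_assoc, smul_assoc, one_smul, one_smul, TensorProduct.smul_tmul, sub_self]

/-- Reconciles two k-structures: that of the quotient of the tensor product over k, and that
restricted from the bimodule structure. -/
theorem algebraMap_smul_bimodTensor (M : Type u) [AddCommGroup M] [Module k M]
    [Module (A ⊗[k] Bᵐᵒᵖ) M] [IsScalarTower k (A ⊗[k] Bᵐᵒᵖ) M]
    (N : Type u) [AddCommGroup N] [Module k N] [Module (B ⊗[k] Cᵐᵒᵖ) N]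
    [IsScalarTower k (B ⊗[k] Cᵐᵒᵖ) N] (r : k) (x : BimodTensor k A B C M N) :
    algebraMap k (A ⊗[k] Cᵐᵒᵖ) r • x = r • x := by
  have h : algebraMap k (A ⊗[k] Cᵐᵒᵖ) r = (r • (1 : A)) ⊗ₜ[k] (1 : Cᵐᵒᵖ) := by
    rw [Algebra.algebraMap_eq_smul_one, ← TensorProduct.smul_tmul']
    rfl
  rw [h]
  induction x using BimodTensor.induction_on with
  | zero => rw [smul_zero, smul_zero]
  | add x y hx hy => rw [smul_add, smul_add, hx, hy]
  | tmul m n =>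
    rw [BimodTensor.smul_tmul, ← TensorProduct.smul_tmul', smul_assoc,
      ← Algebra.TensorProduct.one_def, ← Algebra.TensorProduct.one_def, one_smul, one_smul]
    rfl

/-- If `B` is generated by `k`, then `M ⊗_B N` is `M ⊗_k N`. -/
noncomputable def tensorFunctorObjEquiv (hB : Function.Surjective (algebraMap k B))
    (M : Bimod k A B) (N : Bimod k B C) :
    (M ⊗[k] N) ≃ₗ[k] (((tensorFunctor k A B C).obj M).obj N) :=
  (Submodule.quotEquivOfEqBot _ (balancingRel_eq_bot k hB M N)).symm.trans
    { AddEquiv.refl (BimodTensor k A B C M N) with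
      map_smul' := fun r x => (algebraMap_smul_bimodTensor k M N r x).symm }

theorem finrank_tensorFunctor_obj (hB : Function.Surjective (algebraMap k B))
    (M : Bimod k A B) (N : Bimod k B C) :
    Module.finrank k (((tensorFunctor k A B C).obj M).obj N)
      = Module.finrank k M * Module.finrank k N := by
  rw [← (tensorFunctorObjEquiv k hB M N).finrank_eq, Module.finrank_tensorProduct]

theorem finrank_biproduct {R : Type u} [Ring R] [Algebra k R] {J : Type} [Fintype J]
    (G : J → ModuleCat.{u} R) (hG : ∀ j, Module.Finite k (G j)) :
    Module.finrank k (⨁ G : ModuleCat.{u} R) = ∑ j, Module.finrank k (G j) := by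
  rw [finrank_eq_of_moduleCat_iso k (ModuleCat.biproductIsoPi G), ← Module.finrank_pi_fintype]

-- The terms with i + j = n outside `s ×ˢ t` have dimension 0 and so are zero, which leaves a finite
-- biproduct.
open HomologicalComplex in
theorem finrank_tensorComplex_X (hB : Function.Surjective (algebraMap k B))
    (K : CochainComplex (Bimod k A B) ℤ) (L : CochainComplex (Bimod k B C) ℤ)
    (hK : ∀ i, Module.Finite k (K.X i)) (hL : ∀ i, Module.Finite k (L.X i)) (s t : Finset ℤ)
    (hs : ∀ i, i ∉ s → Module.finrank k (K.X i) = 0)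
    (ht : ∀ i, i ∉ t → Module.finrank k (L.X i) = 0) (n : ℤ) :
    Module.finrank k ((tensorComplex K L).X n) =
      ∑ p ∈ (s ×ˢ t).filter (fun p => p.1 + p.2 = n),
        Module.finrank k (K.X p.1) * Module.finrank k (L.X p.2) := by
  let F := tensorFunctor k A B C
  let S := (s ×ˢ t).filter (fun p => p.1 + p.2 = n)
  let G (p : S) : Bimod k A C := (F.obj (K.X p.1.1)).obj (L.X p.1.2)
  have hp (p : S) : p.1.1 + p.1.2 = n := (Finset.mem_filter.1 p.2).2
  have hfin (i j : ℤ) : Module.Finite k ((F.obj (K.X i)).obj (L.X j)) :=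
    Module.Finite.equiv (tensorFunctorObjEquiv k hB (K.X i) (L.X j))
  let T := CochainComplex.mapBifunctor K L F
  let f : T.X n ⟶ ⨁ G := mapBifunctorDesc fun i j _ =>
    if h : (i, j) ∈ S then biproduct.ι G ⟨(i, j), h⟩ else 0
  let g : ⨁ G ⟶ T.X n :=
    biproduct.desc fun p => CochainComplex.ιMapBifunctor K L F p.1.1 p.1.2 n (hp p)
  have hf {i j : ℤ} (h : (i, j) ∈ S) (hij : i + j = n) :
      CochainComplex.ιMapBifunctor K L F i j n hij ≫ f = biproduct.ι G ⟨(i, j), h⟩ :=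
    (ι_mapBifunctorDesc _ i j hij).trans (dif_pos h)
  have hg (p : S) : biproduct.ι G p ≫ g
      = CochainComplex.ιMapBifunctor K L F p.1.1 p.1.2 n (hp p) := biproduct.ι_desc _ _
  have hgf : g ≫ f = 𝟙 _ := by
    refine biproduct.hom_ext' _ _ fun p => ?_
    rw [reassoc_of% hg p, hf p.2, Category.comp_id]
  have hfg : f ≫ g = 𝟙 _ := by
    refine mapBifunctor.hom_ext fun i j hij => ?_
    by_cases h : (i, j) ∈ S
    · have h1 := hf h hij
      have h2 := hg ⟨(i, j), h⟩
      rw [← h1, Category.assoc] at h2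
      exact h2.trans (Category.comp_id _).symm
    · have h0 : Module.finrank k ((F.obj (K.X i)).obj (L.X j)) = 0 := by
        rw [finrank_tensorFunctor_obj k hB]
        by_cases hi : i ∈ s
        · have hj : j ∉ t := fun hj =>
            h (Finset.mem_filter.2 ⟨Finset.mem_product.2 ⟨hi, hj⟩, hij⟩)
          rw [ht j hj, mul_zero]
        · rw [hs i hi, zero_mul]
      have := hfin i j
      have hsub : Subsingleton ((F.obj (K.X i)).obj (L.X j)) := Module.finrank_zero_iff.1 h0
      exact (ModuleCat.isZero_of_subsingleton _).eq_of_src _ _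
  refine (finrank_eq_of_moduleCat_iso k (⟨f, g, hfg, hgf⟩ : T.X n ≅ ⨁ G)).trans ?_
  rw [finrank_biproduct k G fun p => hfin _ _, ← Finset.sum_coe_sort S]
  exact Finset.sum_congr rfl fun p _ => finrank_tensorFunctor_obj k hB _ _

theorem eulerChar_eq_sum {R : Type u} [Ring R] [Algebra k R]
    (X : DerivedCategory (ModuleCat.{u} R)) (s : Finset ℤ) (hs : ∀ i, i ∉ s → cohomDim k X i = 0) :
    eulerChar k X = ∑ n ∈ s, (n.negOnePow : ℤ) * (cohomDim k X n : ℤ) :=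
  finsum_eq_sum_of_support_subset _ fun n hn => by
    by_contra h
    exact hn (by simp [hs n h])

theorem finite_of_moduleCat_iso {R : Type u} [Ring R] [Algebra k R] {M N : ModuleCat.{u} R}
    (e : M ≅ N) (_ : Module.Finite k M) : Module.Finite k N :=
  Module.Finite.equiv (e.toLinearEquiv.restrictScalars k)

variable {k} in
theorem FiniteTotalCohomology.of_iso {R : Type u} [Ring R] [Algebra k R]
    {X Y : DerivedCategory (ModuleCat.{u} R)} (hX : FiniteTotalCohomology k X) (e : X ≅ Y) :
    FiniteTotalCohomology k Y :=
  ⟨fun n => finite_of_moduleCat_iso k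
      ((DerivedCategory.homologyFunctor (ModuleCat.{u} R) n).mapIso e) (hX.1 n),
    cohomDim_of_iso (k := k) e ▸ hX.2⟩

/-- The Künneth formula for Euler characteristics. -/
theorem eulerChar_tensorComplex [VonNeumannRegular (Bimod k A B)] [VonNeumannRegular (Bimod k B C)]
    (hB : Function.Surjective (algebraMap k B))
    (K : CochainComplex (Bimod k A B) ℤ) (L : CochainComplex (Bimod k B C) ℤ)
    (hK : FiniteTotalCohomology k (DerivedCategory.Q.obj K))
    (hL : FiniteTotalCohomology k (DerivedCategory.Q.obj L)) :
    eulerChar k (DerivedCategory.Q.obj (tensorComplex K L)) =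
      eulerChar k (DerivedCategory.Q.obj K) * eulerChar k (DerivedCategory.Q.obj L) := by
  -- With zero differentials on both factors the total complex has zero differential too, and the
  -- formula becomes a count of dimensions of terms.
  obtain ⟨H, hH, ⟨e⟩⟩ := exists_homotopyEquiv_zero_d K
  obtain ⟨H', hH', ⟨e'⟩⟩ := exists_homotopyEquiv_zero_d L
  have hfinH (i : ℤ) : Module.Finite k (H.X i) :=
    finite_of_moduleCat_iso k
      ((DerivedCategory.homologyFunctorFactors (Bimod k A B) i).app K ≪≫ e.toHomologyIso i ≪≫
        (ShortComplex.HomologyData.ofZeros (H.sc i) (hH _ _) (hH _ _)).left.homologyIso)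
      (hK.1 i)
  have hfinH' (i : ℤ) : Module.Finite k (H'.X i) :=
    finite_of_moduleCat_iso k
      ((DerivedCategory.homologyFunctorFactors (Bimod k B C) i).app L ≪≫ e'.toHomologyIso i ≪≫
        (ShortComplex.HomologyData.ofZeros (H'.sc i) (hH' _ _) (hH' _ _)).left.homologyIso)
      (hL.1 i)
  have hdim (i : ℤ) : cohomDim k (DerivedCategory.Q.obj K) i = Module.finrank k (H.X i) := by
    rw [cohomDim_Q, finrank_eq_of_moduleCat_iso k (e.toHomologyIso i), ← cohomDim_Q,
      cohomDim_Q_of_zero_d k H hH]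
  have hdim' (i : ℤ) : cohomDim k (DerivedCategory.Q.obj L) i = Module.finrank k (H'.X i) := by
    rw [cohomDim_Q, finrank_eq_of_moduleCat_iso k (e'.toHomologyIso i), ← cohomDim_Q,
      cohomDim_Q_of_zero_d k H' hH']
  let s : Finset ℤ := hK.2.toFinset
  let t : Finset ℤ := hL.2.toFinset
  have hs (i : ℤ) (hi : i ∉ s) : Module.finrank k (H.X i) = 0 := by
    rw [← hdim]
    by_contra h
    exact hi (hK.2.mem_toFinset.2 h)
  have ht (i : ℤ) (hi : i ∉ t) : Module.finrank k (H'.X i) = 0 := by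
    rw [← hdim']
    by_contra h
    exact hi (hL.2.mem_toFinset.2 h)
  have hT (n : ℤ) : cohomDim k (DerivedCategory.Q.obj (tensorComplex H H')) n =
      ∑ p ∈ (s ×ˢ t).filter (fun p => p.1 + p.2 = n),
        Module.finrank k (H.X p.1) * Module.finrank k (H'.X p.2) := by
    rw [cohomDim_Q_of_zero_d k (tensorComplex H H') (mapBifunctor_d_eq_zero _ hH hH'),
      finrank_tensorComplex_X k hB H H' hfinH hfinH' s t hs ht]
  obtain ⟨E⟩ := Q_mapBifunctor_iso (tensorFunctor k A B C) e e'
  let r : Finset ℤ := (s ×ˢ t).image fun p => p.1 + p.2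
  rw [eulerChar_of_iso (X := DerivedCategory.Q.obj (tensorComplex K L))
      (Y := DerivedCategory.Q.obj (tensorComplex H H')) E,
    eulerChar_eq_sum k (DerivedCategory.Q.obj K) s fun i hi => (hdim i).trans (hs i hi),
    eulerChar_eq_sum k (DerivedCategory.Q.obj L) t fun i hi => (hdim' i).trans (ht i hi),
    eulerChar_eq_sum k _ r fun n hn => ?_, Finset.sum_mul_sum, ← Finset.sum_product']
  -- Expand the product of alternating sums and group the pairs by total degree.
  · rw [← Finset.sum_fiberwise_of_maps_to (t := r) (g := fun p : ℤ × ℤ => p.1 + p.2)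
      fun p hp => Finset.mem_image_of_mem _ hp]
    refine Finset.sum_congr rfl fun n _ => ?_
    rw [hT, Nat.cast_sum, Finset.mul_sum]
    refine Finset.sum_congr rfl fun p hp => ?_
    rw [← (Finset.mem_filter.1 hp).2, Int.negOnePow_add, hdim, hdim']
    push_cast
    ring
  · rw [hT, Finset.filter_false_of_mem, Finset.sum_empty]
    exact fun p hp h => hn (h ▸ Finset.mem_image_of_mem _ hp)

/-- Composition over an algebra generated by `k` multiplies Euler characteristics. -/
theorem IsComp.eulerChar_mul [Module.Finite k B] [IsSemisimpleRing B] [Module.Finite k C]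
    [IsSemisimpleRing C] [VonNeumannRegular (Bimod k A B)] [VonNeumannRegular (Bimod k B C)]
    (hB : Function.Surjective (algebraMap k B)) {α : MotHom k A B} {β : MotHom k B C}
    {γ : MotHom k A C} (h : IsComp α β γ) :
    MotHom.eulerChar k A C γ = MotHom.eulerChar k A B α * MotHom.eulerChar k B C β := by
  -- The identity to be proved is biadditive, so only a genuine derived tensor product needs an
  -- argument.
  induction h with
  | tensor h hα hβ hγ =>
    obtain ⟨K, L, -, ⟨e⟩, ⟨e'⟩, ⟨e''⟩⟩ := h
    obtain ⟨hM, rfl⟩ := hα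
    obtain ⟨hN, rfl⟩ := hβ
    obtain ⟨hP, rfl⟩ := hγ
    have hK := finiteTotalCohomology_of_rep k _ hM
    have hL := finiteTotalCohomology_of_rep k _ hN
    simp only [MotHom.eulerChar, K0.eulerChar_mk]
    rw [← eulerChar_of_iso e, ← eulerChar_of_iso e', ← eulerChar_of_iso e'',
      eulerChar_tensorComplex k hB K L (hK.of_iso e.symm) (hL.of_iso e'.symm)]
  | zero_left β => simp
  | zero_right α => simp
  | add_left _ _ h h' => rw [map_add, map_add, h, h', add_mul]
  | add_right _ _ h h' => rw [map_add, map_add, h, h', mul_add]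
  | neg_left _ h => rw [map_neg, map_neg, h, neg_mul]
  | neg_right _ h => rw [map_neg, map_neg, h, mul_neg]

end Tensor

/-! ### Dimensions of modules over matrix algebras -/

section MatrixAlgebras

variable (k : Type*) [Field k]

/-- Morita theory: M is W^r for the D-vector space W cut out by a diagonal matrix unit. -/
theorem finrank_dvd_of_matrix_module (D : Type*) [DivisionRing D] [Algebra k D] (r : ℕ) [NeZero r]
    (M : Type*) [AddCommGroup M] [Module k M] [Module (Matrix (Fin r) (Fin r) D) M]
    [IsScalarTower k (Matrix (Fin r) (Fin r) D) M] :
    r * Module.finrank k D ∣ Module.finrank k M := by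
  let M' : ModuleCat (Matrix (Fin r) (Fin r) D) := ModuleCat.of _ M
  let : Module D M' := Module.compHom M' (Matrix.scalar (α := D) (Fin r))
  have := MatrixModCat.isScalarTower_toModuleCat D M'
  let : Module k M' := inferInstanceAs (Module k M)
  have : IsScalarTower k (Matrix (Fin r) (Fin r) D) M' :=
    inferInstanceAs (IsScalarTower k (Matrix (Fin r) (Fin r) D) M)
  have : IsScalarTower k D M' := ⟨fun c d m => by
    change Matrix.scalar (Fin r) (c • d) • m = c • (Matrix.scalar (Fin r) d • m)
    rw [← smul_assoc]
    congr 1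
    ext i j
    simp [Matrix.diagonal_apply]⟩
  let W := MatrixModCat.toModuleCatObj D M' (0 : Fin r)
  let e : M' ≃ₗ[k] (Fin r → W) :=
    { toModuleCatFromModuleCatLinearEquiv D M' 0 with
      map_smul' := fun c m => by
        ext i
        exact smul_comm (Matrix.single 0 i (1 : D)) c m }
  have h : Module.finrank k M = r * (Module.finrank k D * Module.finrank D W) := by
    rw [Module.finrank_mul_finrank k D W]
    refine (e.finrank_eq).trans ?_
    -- If W is infinite-dimensional, both sides are 0 by convention.
    by_cases hW : Module.Finite k W
    · rw [Module.finrank_pi_fintype, Finset.sum_const, Finset.card_univ, Fintype.card_fin,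
        smul_eq_mul]
    · rw [Module.finrank_of_not_finite hW, mul_zero]
      refine Module.finrank_of_not_finite fun h => hW ?_
      exact Module.Finite.of_surjective (LinearMap.proj (0 : Fin r) : (Fin r → W) →ₗ[k] W)
        fun w => ⟨fun _ => w, rfl⟩
  exact ⟨Module.finrank D W, by rw [h, mul_assoc]⟩

theorem finrank_dvd_of_algEquiv {R : Type*} [Ring R] [Algebra k R] {D : Type*} [DivisionRing D]
    [Algebra k D] {r : ℕ} [NeZero r] (e : R ≃ₐ[k] Matrix (Fin r) (Fin r) D)
    (M : Type*) [AddCommGroup M] [Module k M] [Module R M] [IsScalarTower k R M] :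
    r * Module.finrank k D ∣ Module.finrank k M := by
  let : Module (Matrix (Fin r) (Fin r) D) M := Module.compHom M e.symm.toRingEquiv.toRingHom
  have : IsScalarTower k (Matrix (Fin r) (Fin r) D) M := ⟨fun c x m => by
    change e.symm (c • x) • m = c • e.symm x • m
    rw [map_smul, smul_assoc]⟩
  exact finrank_dvd_of_matrix_module k D r M

theorem eq_one_of_mul_sq_dvd {r d : ℕ} (hr : r ≠ 0) (hd : d ≠ 0) (h : (r * d) ^ 2 ∣ r * r * d) :
    d = 1 := by
  obtain ⟨c, hc⟩ := h
  have h1 : r * r * d * (d * c) = r * r * d * 1 :=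
    calc r * r * d * (d * c) = (r * d) ^ 2 * c := by ring
      _ = r * r * d * 1 := by rw [← hc, mul_one]
  exact Nat.eq_one_of_mul_eq_one_right
    (Nat.eq_of_mul_eq_mul_left (by positivity) h1)

variable {k} in
theorem nonempty_matrix_algEquiv {A D : Type*} [Ring A] [Algebra k A] [DivisionRing D] [Algebra k D]
    {r : ℕ} (e : A ≃ₐ[k] Matrix (Fin r) (Fin r) D) (h : Module.finrank k D = 1) :
    Nonempty (A ≃ₐ[k] Matrix (Fin r) (Fin r) k) := by
  have hs : Function.Surjective (algebraMap k D) := by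
    rw [Algebra.surjective_algebraMap_iff]
    exact (Subalgebra.bot_eq_top_of_finrank_eq_one h).symm
  let f : k ≃ₐ[k] D := AlgEquiv.ofBijective (Algebra.ofId k D) ⟨(algebraMap k D).injective, hs⟩
  exact ⟨e.trans f.symm.mapMatrix⟩

variable {k} in
/-- A matrix algebra over a division algebra that becomes a matrix algebra over the base field
after passing to further matrices is a matrix algebra over the base field. -/
theorem finrank_eq_one_of_matrix_algEquiv {A D : Type*} [Ring A] [Algebra k A] [DivisionRing D]
    [Algebra k D] [Module.Finite k D] {r n m : ℕ} [NeZero r] [NeZero n]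
    (e : A ≃ₐ[k] Matrix (Fin r) (Fin r) D)
    (e' : Matrix (Fin n) (Fin n) A ≃ₐ[k] Matrix (Fin m) (Fin m) k) : Module.finrank k D = 1 := by
  let E : Matrix (Fin m) (Fin m) k ≃ₐ[k] Matrix (Fin (n * r)) (Fin (n * r)) D :=
    e'.symm.trans <| e.mapMatrix.trans <| (Matrix.compAlgEquiv _ _ _ _).trans <|
      Matrix.reindexAlgEquiv k D finProdFinEquiv
  let : Module (Matrix (Fin m) (Fin m) k) (Fin m → k) :=
    Module.compHom _ (Matrix.toLinAlgEquiv' (R := k) (n := Fin m)).toRingEquiv.toRingHom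
  have : IsScalarTower k (Matrix (Fin m) (Fin m) k) (Fin m → k) := ⟨fun c x v => by
    change Matrix.toLinAlgEquiv' (c • x) v = c • Matrix.toLinAlgEquiv' x v
    rw [map_smul, LinearMap.smul_apply]⟩
  -- Column vectors of length m give nrd ∣ m, whereas comparing dimensions of the algebras gives m²
  -- = (nr)²d.
  have h1 := finrank_dvd_of_algEquiv k E (Fin m → k)
  have h2 := E.toLinearEquiv.finrank_eq
  rw [Module.finrank_matrix, Module.finrank_matrix, Module.finrank_self, Fintype.card_fin,
    Fintype.card_fin, mul_one] at h2
  rw [Module.finrank_fin_fun] at h1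
  refine eq_one_of_mul_sq_dvd (NeZero.ne (n * r)) Module.finrank_pos.ne' ?_
  rw [← h2, sq]
  exact mul_dvd_mul h1 h1

end MatrixAlgebras

/-! ### Trivial Brauer classes -/

section Brauer

variable {k : Type u} [Field k]

/-- Wedderburn writes A as M_r(D); a Brauer equivalence with k then forces D to be one-dimensional
by the divisibility argument. -/
theorem brauerClass_eq_baseCSA_iff (A : CSA.{u, u} k) :
    brauerClass A = brauerClass (baseCSA k) ↔
      ∃ r : ℕ, r ≠ 0 ∧ Nonempty (A ≃ₐ[k] Matrix (Fin r) (Fin r) k) := by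
  constructor
  · intro h
    obtain ⟨n, m, hn, -, ⟨e'⟩⟩ := Quotient.exact h
    have := NeZero.mk hn
    have : IsArtinianRing A := IsArtinianRing.of_finite k A
    obtain ⟨r, hr, D, _, _, _, ⟨e⟩⟩ := IsSimpleRing.exists_algEquiv_matrix_divisionRing_finite k A
    have e'' : Matrix (Fin n) (Fin n) A ≃ₐ[k] Matrix (Fin m) (Fin m) k := e'
    exact ⟨r, hr.out, nonempty_matrix_algEquiv e (finrank_eq_one_of_matrix_algEquiv e e'')⟩
  · rintro ⟨r, hr, ⟨e⟩⟩
    have E : Matrix (Fin 1) (Fin 1) A ≃ₐ[k] Matrix (Fin (1 * r)) (Fin (1 * r)) k :=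
      e.mapMatrix.trans <| (Matrix.compAlgEquiv _ _ _ _).trans <|
        Matrix.reindexAlgEquiv k k finProdFinEquiv
    exact Quotient.sound ⟨1, 1 * r, one_ne_zero, by rwa [one_mul], ⟨E⟩⟩

end Brauer

/-! ### Bimodules with k on one side -/

section Base

variable (k : Type u) [Field k] {A B : Type u} [Ring A] [Algebra k A] [Ring B] [Algebra k B]

/-- A nontrivial algebra generated by `k` is isomorphic to `k`. -/
noncomputable def baseEquiv [Nontrivial B] (hB : Function.Surjective (algebraMap k B)) : k ≃ₐ[k] B :=
  AlgEquiv.ofBijective (Algebra.ofId k B) ⟨(algebraMap k B).injective, hB⟩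

/-- `A ⊗ Bᵒᵖ` is `A` if `B` is `k`. -/
noncomputable def tensorOpBaseEquiv (e : k ≃ₐ[k] B) : A ⊗[k] Bᵐᵒᵖ ≃ₐ[k] A :=
  (Algebra.TensorProduct.congr AlgEquiv.refl
    ((AlgEquiv.toOpposite k k).trans (AlgEquiv.op e)).symm).trans (Algebra.TensorProduct.rid k k A)

/-- `B ⊗ Aᵒᵖ` is `Aᵒᵖ` if `B` is `k`. -/
noncomputable def baseTensorOpEquiv (e : k ≃ₐ[k] B) : B ⊗[k] Aᵐᵒᵖ ≃ₐ[k] Aᵐᵒᵖ :=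
  (Algebra.TensorProduct.congr e.symm AlgEquiv.refl).trans (Algebra.TensorProduct.lid k Aᵐᵒᵖ)

/-- The enveloping algebra here is A itself, so its semisimplicity needs no separability. -/
theorem vonNeumannRegular_bimod_base [IsSemisimpleRing A] (e : k ≃ₐ[k] B) :
    VonNeumannRegular (Bimod k A B) :=
  have := (tensorOpBaseEquiv k (A := A) e).symm.toRingEquiv.isSemisimpleRing
  inferInstance

theorem vonNeumannRegular_base_bimod [IsSemisimpleRing A] (e : k ≃ₐ[k] B) :
    VonNeumannRegular (Bimod k B A) :=
  have := (baseTensorOpEquiv k (A := A) e).symm.toRingEquiv.isSemisimpleRing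
  inferInstance

theorem finrank_op_eq (D : Type*) [Ring D] [Algebra k D] : Module.finrank k Dᵐᵒᵖ = Module.finrank k D :=
  (MulOpposite.opLinearEquiv k).symm.finrank_eq

open scoped ModuleCat

theorem finrank_dvd_bimod_base {D : Type*} [DivisionRing D] [Algebra k D] {r : ℕ} [NeZero r]
    (f : A ≃ₐ[k] Matrix (Fin r) (Fin r) D) (e : k ≃ₐ[k] B) (M : Bimod k A B) :
    r * Module.finrank k D ∣ Module.finrank k M :=
  finrank_dvd_of_algEquiv k ((tensorOpBaseEquiv k e).trans f) M

/-- The opposite of M_r(D) is M_r(Dᵐᵒᵖ), and Dᵐᵒᵖ has the same dimension as D. -/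
theorem finrank_dvd_base_bimod {D : Type*} [DivisionRing D] [Algebra k D] {r : ℕ} [NeZero r]
    (f : A ≃ₐ[k] Matrix (Fin r) (Fin r) D) (e : k ≃ₐ[k] B) (M : Bimod k B A) :
    r * Module.finrank k D ∣ Module.finrank k M := by
  rw [← finrank_op_eq]
  exact finrank_dvd_of_algEquiv k
    ((baseTensorOpEquiv k e).trans ((AlgEquiv.op f).trans AlgEquiv.mopMatrix.symm)) M

end Base

/-! ### The universal property of the bimodule tensor product -/

section Lift

set_option linter.unusedSectionVars false

variable (k : Type u) [Field k] {A B C : Type u} [Ring A] [Algebra k A] [Ring B] [Algebra k B]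
  [Ring C] [Algebra k C]
  {M : Type u} [AddCommGroup M] [Module k M] [Module (A ⊗[k] Bᵐᵒᵖ) M]
  [IsScalarTower k (A ⊗[k] Bᵐᵒᵖ) M]
  {N : Type u} [AddCommGroup N] [Module k N] [Module (B ⊗[k] Cᵐᵒᵖ) N]
  [IsScalarTower k (B ⊗[k] Cᵐᵒᵖ) N]

theorem BimodTensor.tmul_balanced (m : M) (b : B) (n : N) :
    BimodTensor.tmul k A B C (((1 : A) ⊗ₜ[k] MulOpposite.op b) • m) n
      = BimodTensor.tmul k A B C m ((b ⊗ₜ[k] (1 : Cᵐᵒᵖ)) • n) :=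
  (Submodule.Quotient.eq _).2 (Submodule.subset_span ⟨m, b, n, rfl⟩)

variable {P : Type u} [AddCommGroup P] [Module (A ⊗[k] Cᵐᵒᵖ) P]

/-- The universal property of `M ⊗_B N`. -/
theorem BimodTensor.exists_lift (f : M →+ N →+ P)
    (hbal : ∀ m (b : B) n, f (((1 : A) ⊗ₜ[k] MulOpposite.op b) • m) n
      = f m ((b ⊗ₜ[k] (1 : Cᵐᵒᵖ)) • n))
    (hact : ∀ (a : A) (c : Cᵐᵒᵖ) m n, f ((a ⊗ₜ[k] (1 : Bᵐᵒᵖ)) • m) (((1 : B) ⊗ₜ[k] c) • n)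
      = (a ⊗ₜ[k] c) • f m n) :
    ∃ F : BimodTensor k A B C M N →ₗ[A ⊗[k] Cᵐᵒᵖ] P,
      ∀ m n, F (BimodTensor.tmul k A B C m n) = f m n := by
  -- With this k-structure, k-bilinearity of f follows from `hact` applied to scalar multiples of 1.
  let : Module k P := Module.compHom P (algebraMap k (A ⊗[k] Cᵐᵒᵖ))
  have hk (r : k) (p : P) : r • p = (algebraMap k (A ⊗[k] Cᵐᵒᵖ) r) • p := rfl
  have hl (r : k) (m : M) (n : N) : f (r • m) n = r • f m n := by
    have h := hact (r • 1) 1 m n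
    rw [← TensorProduct.smul_tmul', ← TensorProduct.smul_tmul', smul_assoc,
      ← Algebra.TensorProduct.one_def, ← Algebra.TensorProduct.one_def,
      ← Algebra.TensorProduct.one_def, one_smul, one_smul] at h
    rw [h, hk, Algebra.algebraMap_eq_smul_one]
  have hr (r : k) (m : M) (n : N) : f m (r • n) = r • f m n := by
    have h := hact 1 (r • 1) m n
    rw [TensorProduct.tmul_smul, TensorProduct.tmul_smul, smul_assoc,
      ← Algebra.TensorProduct.one_def, ← Algebra.TensorProduct.one_def,
      ← Algebra.TensorProduct.one_def, one_smul, one_smul] at h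
    rw [h, hk, Algebra.algebraMap_eq_smul_one]
  let f₀ : M ⊗[k] N →ₗ[k] P := TensorProduct.lift (LinearMap.mk₂ k (fun m n => f m n)
    (fun m m' n => by rw [map_add, AddMonoidHom.add_apply]) hl (fun m n n' => map_add _ _ _) hr)
  let F : BimodTensor k A B C M N →ₗ[k] P := Submodule.liftQ _ f₀ (by
    rw [balancingRel, Submodule.span_le]
    rintro _ ⟨m, b, n, rfl⟩
    refine (map_sub f₀ _ _).trans (sub_eq_zero.2 ?_)
    exact hbal m b n)
  have hF (m : M) (n : N) : F (BimodTensor.tmul k A B C m n) = f m n := rfl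
  refine ⟨{ F with map_smul' := fun r x => ?_ }, hF⟩
  change F (r • x) = r • F x
  induction r using TensorProduct.induction_on with
  | zero =>
    have h : (0 : A ⊗[k] Cᵐᵒᵖ) • x = 0 :=
      DFunLike.congr_fun (map_zero (BimodTensor.action k A B C M N)) x
    exact ((congrArg F h).trans (map_zero F)).trans (zero_smul (A ⊗[k] Cᵐᵒᵖ) (F x)).symm
  | add r s hr hs => rw [add_smul, map_add, hr, hs, add_smul]
  | tmul a c =>
    induction x using BimodTensor.induction_on with
    | zero => rw [smul_zero, map_zero, smul_zero]
    | add x y hx hy => rw [smul_add, map_add, hx, hy, map_add, smul_add]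
    | tmul m n => rw [BimodTensor.smul_tmul, hF, hF, hact]

end Lift

/-! ### Column and row vectors as a Morita equivalence -/

section MatrixBimodules

open Matrix

variable {k : Type u} [Field k] {A : Type u} [Ring A] [Algebra k A] {r : ℕ}
  {B : Type u} [Ring B] [Algebra k B] (e : A ≃ₐ[k] Matrix (Fin r) (Fin r) k) (b : k ≃ₐ[k] B)

/-- The action of `A ⊗ Bᵒᵖ` on column vectors. -/
noncomputable def columnAction : A ⊗[k] Bᵐᵒᵖ →ₐ[k] Module.End k (Fin r → k) :=
  (Matrix.toLinAlgEquiv'.toAlgHom.comp e.toAlgHom).comp (tensorOpBaseEquiv k b).toAlgHom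

/-- The action of `B ⊗ Aᵒᵖ` on row vectors. -/
noncomputable def rowAction : B ⊗[k] Aᵐᵒᵖ →ₐ[k] Module.End k (Fin r → k) :=
  (Matrix.toLinAlgEquiv'.toAlgHom.comp ((Matrix.transposeAlgEquiv (Fin r) k k).symm.toAlgHom.comp
    (AlgEquiv.op e).toAlgHom)).comp (baseTensorOpEquiv k b).toAlgHom

/-- Column vectors, as a bimodule over a matrix algebra `A` and the base field `B`. -/
noncomputable def columnBimod : Bimod k A B :=
  let : Module (A ⊗[k] Bᵐᵒᵖ) (Fin r → k) := Module.compHom _ (columnAction e b).toRingHom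
  ModuleCat.of (A ⊗[k] Bᵐᵒᵖ) (Fin r → k)

/-- Row vectors, as a bimodule over the base field `B` and a matrix algebra `A`. -/
noncomputable def rowBimod : Bimod k B A :=
  let : Module (B ⊗[k] Aᵐᵒᵖ) (Fin r → k) := Module.compHom _ (rowAction e b).toRingHom
  ModuleCat.of (B ⊗[k] Aᵐᵒᵖ) (Fin r → k)

open scoped ModuleCat

/-- The identification of the column bimodule with `Fin r → k`. -/
noncomputable def column : (Fin r → k) ≃ₗ[k] columnBimod e b :=
  { AddEquiv.refl (Fin r → k) with
    map_smul' := fun c v => (DFunLike.congr_fun ((columnAction e b).commutes c) v).symm }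

/-- The identification of the row bimodule with `Fin r → k`. -/
noncomputable def row : (Fin r → k) ≃ₗ[k] rowBimod e b :=
  { AddEquiv.refl (Fin r → k) with
    map_smul' := fun c v => (DFunLike.congr_fun ((rowAction e b).commutes c) v).symm }

theorem smul_column (a : A) (c : k) (v : Fin r → k) :
    (a ⊗ₜ[k] MulOpposite.op (b c)) • column e b v = column e b (c • e a *ᵥ v) := by
  change columnAction e b (a ⊗ₜ[k] MulOpposite.op (b c)) v = (c • e a *ᵥ v : Fin r → k)
  simp [columnAction, tensorOpBaseEquiv]

theorem smul_row (a : A) (c : k) (v : Fin r → k) :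
    (b c ⊗ₜ[k] MulOpposite.op a) • row e b v = row e b (c • v ᵥ* e a) := by
  change rowAction e b (b c ⊗ₜ[k] MulOpposite.op a) v = (c • v ᵥ* e a : Fin r → k)
  simp [rowAction, baseTensorOpEquiv, Matrix.mulVec_transpose]

theorem smul_column_left (a : A) (v : Fin r → k) :
    (a ⊗ₜ[k] (1 : Bᵐᵒᵖ)) • column e b v = column e b (e a *ᵥ v) := by
  simpa using smul_column e b a 1 v

theorem smul_row_right (a : A) (v : Fin r → k) :
    ((1 : B) ⊗ₜ[k] MulOpposite.op a) • row e b v = row e b (v ᵥ* e a) := by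
  simpa using smul_row e b a 1 v

theorem smul_column_right (c : k) (v : Fin r → k) :
    ((1 : A) ⊗ₜ[k] MulOpposite.op (b c)) • column e b v = column e b (c • v) := by
  simpa using smul_column e b 1 c v

theorem smul_row_left (c : k) (v : Fin r → k) :
    (b c ⊗ₜ[k] (1 : Aᵐᵒᵖ)) • row e b v = row e b (c • v) := by
  simpa using smul_row e b 1 c v

/-- Pure tensors in `Column ⊗_B Row`, as a biadditive map. -/
noncomputable def columnTmulRow :
    (Fin r → k) →+ (Fin r → k) →+ BimodTensor k A B A (columnBimod e b) (rowBimod e b) :=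
  AddMonoidHom.mk' (fun w => AddMonoidHom.mk'
      (fun v => BimodTensor.tmul k A B A (column e b w) (row e b v))
      fun v v' => by rw [map_add, BimodTensor.tmul_add])
    fun w w' => AddMonoidHom.ext fun v => by
      simp only [AddMonoidHom.mk'_apply, AddMonoidHom.add_apply]
      rw [map_add, BimodTensor.add_tmul]

/-- Pure tensors in `Row ⊗_A Column`, as a biadditive map. -/
noncomputable def rowTmulColumn :
    (Fin r → k) →+ (Fin r → k) →+ BimodTensor k B A B (rowBimod e b) (columnBimod e b) :=
  AddMonoidHom.mk' (fun v => AddMonoidHom.mk'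
      (fun w => BimodTensor.tmul k B A B (row e b v) (column e b w))
      fun v v' => by rw [map_add, BimodTensor.tmul_add])
    fun w w' => AddMonoidHom.ext fun v => by
      simp only [AddMonoidHom.mk'_apply, AddMonoidHom.add_apply]
      rw [map_add, BimodTensor.add_tmul]

theorem columnTmulRow_smul (c : k) (w v : Fin r → k) :
    columnTmulRow e b (c • w) v = columnTmulRow e b w (c • v) := by
  have h := BimodTensor.tmul_balanced k (A := A) (B := B) (C := A) (column e b w) (b c) (row e b v)
  rwa [smul_column_right, smul_row_left] at h

theorem rowTmulColumn_vecMul (a : A) (v w : Fin r → k) :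
    rowTmulColumn e b (v ᵥ* e a) w = rowTmulColumn e b v (e a *ᵥ w) := by
  have h := BimodTensor.tmul_balanced k (A := B) (B := A) (C := B) (row e b v) a (column e b w)
  rwa [smul_column_left, smul_row_right] at h

/-- `Column ⊗_B Row` is the matrix algebra. -/
theorem nonempty_column_tensor_row_iso :
    Nonempty (((tensorFunctor k A B A).obj (columnBimod e b)).obj (rowBimod e b) ≅ idBimod k A) := by
  let : Module (A ⊗[k] Aᵐᵒᵖ) A := TensorProduct.Algebra.module
  let f₀ (w v : Fin r → k) : A := e.symm (vecMulVec w v)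
  let f : columnBimod e b →+ rowBimod e b →+ A :=
    AddMonoidHom.mk' (fun w => AddMonoidHom.mk' (fun v => f₀ ((column e b).symm w) ((row e b).symm v))
      fun v v' => by simp only [f₀, map_add, vecMulVec_add])
    fun w w' => AddMonoidHom.ext fun v => by simp [f₀, add_vecMulVec]
  have hf (w v : Fin r → k) : f (column e b w) (row e b v) = f₀ w v := by simp [f]
  obtain ⟨F, hF⟩ := BimodTensor.exists_lift k f (by
    intro w x v
    obtain ⟨c, rfl⟩ := b.surjective x
    obtain ⟨w, rfl⟩ := (column e b).surjective w
    obtain ⟨v, rfl⟩ := (row e b).surjective v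
    rw [smul_column_right, smul_row_left, hf, hf]
    simp only [f₀, smul_vecMulVec, vecMulVec_smul]) (by
    intro a x w v
    obtain ⟨a', rfl⟩ := MulOpposite.op_surjective x
    obtain ⟨w, rfl⟩ := (column e b).surjective w
    obtain ⟨v, rfl⟩ := (row e b).surjective v
    rw [smul_column_left, smul_row_right, hf, hf]
    change e.symm (vecMulVec (e a *ᵥ w) (v ᵥ* e a')) = a * (f₀ w v * a')
    rw [← mul_vecMulVec, ← vecMulVec_mul, map_mul, map_mul, e.symm_apply_apply,
      e.symm_apply_apply])
  have hF' (w v : Fin r → k) : F (columnTmulRow e b w v) = e.symm (vecMulVec w v) :=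
    (hF _ _).trans (hf w v)
  -- Reconstruction from the matrix: x is the sum of its i-th column tensored with the i-th basis
  -- row. Injectivity of F follows at once.
  have hrec (x : BimodTensor k A B A (columnBimod e b) (rowBimod e b)) :
      x = ∑ i, columnTmulRow e b ((e (F x)).col i) (Pi.single i 1) := by
    induction x using BimodTensor.induction_on with
    | zero =>
      simp only [map_zero]
      exact (Finset.sum_eq_zero fun i _ => DFunLike.congr_fun (map_zero (columnTmulRow e b)) _).symm
    | add x y hx hy =>
      nth_rw 1 [hx, hy]
      rw [← Finset.sum_add_distrib]
      refine Finset.sum_congr rfl fun i _ => ?_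
      have h : (e (F (x + y))).col i = (e (F x)).col i + (e (F y)).col i := by
        rw [map_add, map_add]
        rfl
      rw [h, map_add, AddMonoidHom.add_apply]
    | tmul w v =>
      obtain ⟨w, rfl⟩ := (column e b).surjective w
      obtain ⟨v, rfl⟩ := (row e b).surjective v
      have h1 : ∀ i, (e (F (columnTmulRow e b w v))).col i = v i • w := fun i => by
        rw [hF', e.apply_symm_apply]
        ext j
        simp [vecMulVec_apply, mul_comm]
      change columnTmulRow e b w v
        = ∑ i, columnTmulRow e b ((e (F (columnTmulRow e b w v))).col i) (Pi.single i 1)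
      simp only [h1, columnTmulRow_smul]
      rw [← map_sum]
      congr 1
      ext j
      simp [Pi.single_apply]
  have hbij : Function.Bijective F := by
    refine ⟨(injective_iff_map_eq_zero F).2 fun x hx => ?_, fun a => ?_⟩
    · rw [hrec x, hx, map_zero]
      exact Finset.sum_eq_zero fun i _ => DFunLike.congr_fun (map_zero (columnTmulRow e b)) _
    · refine ⟨∑ i, columnTmulRow e b ((e a).col i) (Pi.single i 1), ?_⟩
      rw [map_sum]
      simp only [hF']
      rw [← map_sum, AlgEquiv.symm_apply_eq]
      ext i j
      simp [Matrix.sum_apply, vecMulVec_apply, Pi.single_apply]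
  exact ⟨(LinearEquiv.ofBijective F hbij).toModuleIso⟩

/-- `Row ⊗_A Column` is the base field. -/
theorem nonempty_row_tensor_column_iso [NeZero r] :
    Nonempty (((tensorFunctor k B A B).obj (rowBimod e b)).obj (columnBimod e b) ≅ idBimod k B) := by
  let : Module (B ⊗[k] Bᵐᵒᵖ) B := TensorProduct.Algebra.module
  let f₀ (v w : Fin r → k) : B := b (v ⬝ᵥ w)
  let f : rowBimod e b →+ columnBimod e b →+ B :=
    AddMonoidHom.mk' (fun v => AddMonoidHom.mk' (fun w => f₀ ((row e b).symm v) ((column e b).symm w))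
      fun v v' => by simp only [f₀, map_add, dotProduct_add])
    fun w w' => AddMonoidHom.ext fun v => by simp [f₀, add_dotProduct]
  have hf (v w : Fin r → k) : f (row e b v) (column e b w) = f₀ v w := by simp [f]
  obtain ⟨F, hF⟩ := BimodTensor.exists_lift k f (by
    intro v a w
    obtain ⟨w, rfl⟩ := (column e b).surjective w
    obtain ⟨v, rfl⟩ := (row e b).surjective v
    rw [smul_column_left, smul_row_right, hf, hf]
    simp only [f₀, dotProduct_mulVec]) (by
    intro x y v w
    obtain ⟨y, rfl⟩ := MulOpposite.op_surjective y
    obtain ⟨c, rfl⟩ := b.surjective x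
    obtain ⟨d, rfl⟩ := b.surjective y
    obtain ⟨w, rfl⟩ := (column e b).surjective w
    obtain ⟨v, rfl⟩ := (row e b).surjective v
    rw [smul_column_right, smul_row_left, hf, hf]
    change b ((c • v) ⬝ᵥ (d • w)) = b c * (b (v ⬝ᵥ w) * b d)
    rw [← map_mul, ← map_mul, smul_dotProduct, dotProduct_smul, smul_eq_mul, smul_eq_mul,
      mul_comm d])
  have hF' (v w : Fin r → k) : F (rowTmulColumn e b v w) = b (v ⬝ᵥ w) := (hF _ _).trans (hf v w)
  let u : Fin r → k := Pi.single 0 1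
  -- Every tensor is u ⊗ F(x)u. The rank-one matrix uvᵀ sends the row u to v and the column w to (v
  -- · w)u, so moving it across gives v ⊗ w = u ⊗ (v · w)u.
  have hrec (x : BimodTensor k B A B (rowBimod e b) (columnBimod e b)) :
      x = rowTmulColumn e b u (b.symm (F x) • u) := by
    induction x using BimodTensor.induction_on with
    | zero => simp
    | add x y hx hy =>
      nth_rw 1 [hx, hy]
      rw [← map_add, ← add_smul, ← map_add, ← map_add]
    | tmul v w =>
      obtain ⟨w, rfl⟩ := (column e b).surjective w
      obtain ⟨v, rfl⟩ := (row e b).surjective v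
      change rowTmulColumn e b v w
        = rowTmulColumn e b u (b.symm (F (rowTmulColumn e b v w)) • u)
      have h := rowTmulColumn_vecMul e b (e.symm (vecMulVec u v)) u w
      rw [e.apply_symm_apply, vecMul_vecMulVec, vecMulVec_mulVec] at h
      have hu : u ⬝ᵥ u = 1 := by simp [u]
      rw [hu, one_smul] at h
      rw [hF', b.symm_apply_apply, h, op_smul_eq_smul]
  have hbij : Function.Bijective F := by
    refine ⟨(injective_iff_map_eq_zero F).2 fun x hx => ?_, fun c => ?_⟩
    · rw [hrec x, hx, map_zero, zero_smul, map_zero]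
    · refine ⟨rowTmulColumn e b u (b.symm c • u), ?_⟩
      rw [hF']
      simp [u]
  exact ⟨(LinearEquiv.ofBijective F hbij).toModuleIso⟩

end MatrixBimodules

/-! ### Motives of matrix algebras -/

section MatrixMotives

open scoped ModuleCat

variable {k : Type u} [Field k] {A B C : Type u} [Ring A] [Algebra k A] [Ring B] [Algebra k B]
  [Ring C] [Algebra k C]

theorem finite_forgetLeft (M : Bimod k A B) [Module.Finite k M] :
    Module.Finite Bᵐᵒᵖ ((forgetLeft k A B).obj M) := by
  have : Module.Finite k ((forgetLeft k A B).obj M) :=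
    Module.Finite.equiv (forgetLeftLinearEquiv k A B M).symm
  exact Module.Finite.of_restrictScalars_finite k Bᵐᵒᵖ _

theorem rep_single [IsSemisimpleRing B] (M : Bimod k A B) [Module.Finite k M] :
    rep k A B ((DerivedCategory.singleFunctor (Bimod k A B) 0).obj M) :=
  rep_Q_single k M (finite_forgetLeft M)

/-- The identification of the bimodule `A` with `A`. -/
noncomputable def idBimodEquiv (A : Type u) [Ring A] [Algebra k A] : A ≃ₗ[k] idBimod k A :=
  { AddEquiv.refl A with
    map_smul' := fun c a => by
      have h : algebraMap k (A ⊗[k] Aᵐᵒᵖ) c = (c • (1 : A)) ⊗ₜ[k] MulOpposite.op (1 : A) := by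
        rw [Algebra.algebraMap_eq_smul_one, ← TensorProduct.smul_tmul']
        rfl
      refine Eq.trans ?_ (congrArg (fun t : A ⊗[k] Aᵐᵒᵖ => t • (show idBimod k A from a)) h).symm
      change c • a = (c • (1 : A)) * (a * 1)
      rw [mul_one, smul_one_mul] }

theorem rep_idObj [IsSemisimpleRing A] [Module.Finite k A] : rep k A A (idObj k A) :=
  have := Module.Finite.equiv (idBimodEquiv (k := k) A)
  rep_single (idBimod k A)

theorem eulerChar_idObj : eulerChar k (idObj k A) = Module.finrank k A := by
  refine (eulerChar_Q_single k (idBimod k A) 0).trans ?_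
  rw [← (idBimodEquiv (k := k) A).finrank_eq]
  simp

/-- Regularity makes the one-term complex on M K-projective, so the ordinary tensor product already
computes the derived one. -/
theorem isComp_of_tensorFunctor_iso [VonNeumannRegular (Bimod k A B)] {M : Bimod k A B}
    {N : Bimod k B C} {P : Bimod k A C} (i : ((tensorFunctor k A B C).obj M).obj N ≅ P)
    (hM : rep k A B ((DerivedCategory.singleFunctor _ 0).obj M))
    (hN : rep k B C ((DerivedCategory.singleFunctor _ 0).obj N))
    (hP : rep k A C ((DerivedCategory.singleFunctor _ 0).obj P)) :
    IsComp (K0.mk (rep k A B) _ hM) (K0.mk (rep k B C) _ hN) (K0.mk (rep k A C) _ hP) := by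
  obtain ⟨j⟩ := mapBifunctor_single (tensorFunctor k A B C) M N
  refine IsComp.tensor (M := (DerivedCategory.singleFunctor _ 0).obj M)
    (N := (DerivedCategory.singleFunctor _ 0).obj N)
    (P := (DerivedCategory.singleFunctor _ 0).obj P)
    ⟨(HomologicalComplex.single _ (ComplexShape.up ℤ) 0).obj M,
      (HomologicalComplex.single _ (ComplexShape.up ℤ) 0).obj N, inferInstance, ⟨Iso.refl _⟩,
      ⟨Iso.refl _⟩, ⟨?_⟩⟩ ⟨hM, rfl⟩ ⟨hN, rfl⟩ ⟨hP, rfl⟩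
  exact DerivedCategory.Q.mapIso j.symm ≪≫ (DerivedCategory.singleFunctor (Bimod k A C) 0).mapIso i

/-- A matrix algebra over `k` is isomorphic to `k` as a noncommutative motive. -/
theorem exists_inverse_of_matrix {r : ℕ} [NeZero r] [IsSemisimpleRing A] [IsSemisimpleRing B]
    (e : A ≃ₐ[k] Matrix (Fin r) (Fin r) k) (b : k ≃ₐ[k] B) :
    ∃ (α : MotHom k A B) (β : MotHom k B A) (ε : MotHom k A A) (ε' : MotHom k B B),
      IsClassOf (idObj k A) ε ∧ IsClassOf (idObj k B) ε' ∧ IsComp α β ε ∧ IsComp β α ε' := by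
  have := vonNeumannRegular_bimod_base k (A := A) b
  have := vonNeumannRegular_base_bimod k (A := A) b
  have := Module.Finite.equiv (column e b)
  have := Module.Finite.equiv (row e b)
  have : Module.Finite k A := Module.Finite.equiv e.symm.toLinearEquiv
  have : Module.Finite k B := Module.Finite.equiv b.toLinearEquiv
  obtain ⟨i⟩ := nonempty_column_tensor_row_iso e b
  obtain ⟨j⟩ := nonempty_row_tensor_column_iso e b
  exact ⟨_, _, _, _, ⟨rep_idObj, rfl⟩, ⟨rep_idObj, rfl⟩,
    isComp_of_tensorFunctor_iso i (rep_single _) (rep_single _) rep_idObj,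
    isComp_of_tensorFunctor_iso j (rep_single _) (rep_single _) rep_idObj⟩

/-- If the identity of `U(A)` factors through a sum of copies of `U(k)`, then the division algebra
underlying `A` is one-dimensional. -/
theorem finrank_eq_one_of_isComp {D : Type u} [DivisionRing D] [Algebra k D] [Module.Finite k D]
    {r : ℕ} [NeZero r] [IsSemisimpleRing A] [IsSemisimpleRing B]
    (e : A ≃ₐ[k] Matrix (Fin r) (Fin r) D) (b : k ≃ₐ[k] B) {J : Type} [Fintype J]
    (α : J → MotHom k A B) (β : J → MotHom k B A) (t : J → MotHom k A A) {ε : MotHom k A A}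
    (ht : ∀ j, IsComp (α j) (β j) (t j)) (hε : IsClassOf (idObj k A) ε) (hsum : ε = ∑ j, t j) :
    Module.finrank k D = 1 := by
  have := vonNeumannRegular_bimod_base k (A := A) b
  have := vonNeumannRegular_base_bimod k (A := A) b
  have : Module.Finite k A := Module.Finite.equiv e.symm.toLinearEquiv
  have : Module.Finite k B := Module.Finite.equiv b.toLinearEquiv
  have hB : Function.Surjective (algebraMap k B) := fun x => ⟨b.symm x, by
    rw [← b.commutes, Algebra.algebraMap_self_apply, b.apply_symm_apply]⟩
  obtain ⟨h, rfl⟩ := hε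
  have h1 : (Module.finrank k A : ℤ) = ∑ j, MotHom.eulerChar k A A (t j) := by
    rw [← map_sum, ← hsum, MotHom.eulerChar, K0.eulerChar_mk, eulerChar_idObj]
  -- Each summand is χ(α j) χ(β j), and rd divides both factors.
  have h2 : (((r * Module.finrank k D) ^ 2 : ℕ) : ℤ) ∣ (Module.finrank k A : ℤ) := by
    rw [h1]
    refine Finset.dvd_sum fun j _ => ?_
    rw [(ht j).eulerChar_mul k hB, sq, Nat.cast_mul]
    exact mul_dvd_mul (K0.dvd_eulerChar k _ (finrank_dvd_bimod_base k e b) _)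
      (K0.dvd_eulerChar k _ (finrank_dvd_base_bimod k e b) _)
  rw [e.toLinearEquiv.finrank_eq, Module.finrank_matrix, Fintype.card_fin] at h2
  exact eq_one_of_mul_sq_dvd (NeZero.ne r) Module.finrank_pos.ne' (Int.natCast_dvd_natCast.1 h2)

end MatrixMotives

/-! ### Diagonal matrices of morphisms -/

section Diagonal

variable {k : Type u} [Field k] {ι : Type} [Fintype ι]

open scoped Classical in
/-- The diagonal matrix of morphisms of noncommutative motives. -/
noncomputable def Motive.diagonal {A B : ι → AlgCat.{u} k} (α : ∀ i, MotHom k (A i) (B i)) :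
    (sumU A).Hom (sumU B) := fun (i j : ι) =>
  if h : i = j then (h ▸ α i : MotHom k (A i) (B j)) else 0

theorem Motive.diagonal_self {A B : ι → AlgCat.{u} k} (α : ∀ i, MotHom k (A i) (B i)) (i : ι) :
    Motive.diagonal α i i = α i :=
  dif_pos rfl

theorem Motive.diagonal_of_ne {A B : ι → AlgCat.{u} k} (α : ∀ i, MotHom k (A i) (B i)) {i j : ι}
    (h : i ≠ j) : Motive.diagonal α i j = 0 :=
  dif_neg h

theorem Motive.isId_diagonal {A : ι → AlgCat.{u} k} {ε : ∀ i, MotHom k (A i) (A i)}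
    (h : ∀ i, IsClassOf (idObj k (A i)) (ε i)) : Motive.IsId (Motive.diagonal ε) :=
  ⟨fun i => (Motive.diagonal_self ε i).symm ▸ h i, fun _ _ => Motive.diagonal_of_ne ε⟩

theorem Motive.isComp_diagonal {A B C : ι → AlgCat.{u} k} {α : ∀ i, MotHom k (A i) (B i)}
    {β : ∀ i, MotHom k (B i) (C i)} {γ : ∀ i, MotHom k (A i) (C i)}
    (h : ∀ i, NCMotive.IsComp (α i) (β i) (γ i)) :
    Motive.IsComp (Motive.diagonal α) (Motive.diagonal β) (Motive.diagonal γ) := by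
  classical
  intro (i : ι) (l : ι)
  let γ' : MotHom k (A i) (C l) := Motive.diagonal γ i l
  -- Only j = i contributes to entry (i, l); all other summands have a zero left factor.
  refine ⟨fun (j : ι) => if i = j then γ' else 0, fun (j : ι) => ?_, ?_⟩
  · change NCMotive.IsComp _ _ (if i = j then γ' else 0)
    split_ifs with hij
    · subst hij
      rw [Motive.diagonal_self]
      by_cases hil : i = l
      · subst hil
        simp only [γ']
        rw [Motive.diagonal_self, Motive.diagonal_self]
        exact h i
      · simp only [γ']
        rw [Motive.diagonal_of_ne _ hil, Motive.diagonal_of_ne _ hil]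
        exact .zero_right _
    · rw [Motive.diagonal_of_ne _ hij]
      exact .zero_left _
  · exact ((Finset.sum_ite_eq Finset.univ i fun _ : ι => γ').trans
      (if_pos (Finset.mem_univ i))).symm

theorem Motive.isomorphic_sumU {A B : ι → AlgCat.{u} k}
    (h : ∀ i, ∃ (α : MotHom k (A i) (B i)) (β : MotHom k (B i) (A i)) (ε : MotHom k (A i) (A i))
      (ε' : MotHom k (B i) (B i)), IsClassOf (idObj k (A i)) ε ∧ IsClassOf (idObj k (B i)) ε' ∧
        NCMotive.IsComp α β ε ∧ NCMotive.IsComp β α ε') :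
    Motive.Isomorphic (sumU A) (sumU B) := by
  choose α β ε ε' hε hε' hαβ hβα using h
  exact ⟨_, _, _, _, Motive.isId_diagonal hε, Motive.isId_diagonal hε',
    Motive.isComp_diagonal hαβ, Motive.isComp_diagonal hβα⟩

end Diagonal

end NCMotive

/-! ### The theorem -/

theorem proposition8p2 {k : Type u} [Field k] {n : ℕ} (A : Fin n → CSA.{u, u} k) :
    NCMotive.Motive.Isomorphic (NCMotive.sumU fun i => (A i).toAlgCat)
        (NCMotive.sumU fun _ : Fin n => (NCMotive.baseCSA k).toAlgCat) ↔
      ∀ i, NCMotive.brauerClass (A i) = NCMotive.brauerClass (NCMotive.baseCSA k) := by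
  let b : k ≃ₐ[k] NCMotive.baseCSA k :=
    NCMotive.baseEquiv k (B := NCMotive.baseCSA k) fun x => ⟨x, rfl⟩
  have (R : CSA.{u, u} k) : IsArtinianRing R := IsArtinianRing.of_finite k R
  constructor
  · rintro ⟨f, g, ε, -, hε, -, hfg, -⟩ i
    obtain ⟨r, hr, D, _, _, _, ⟨e⟩⟩ :=
      IsSimpleRing.exists_algEquiv_matrix_divisionRing_finite k (A i)
    -- The (i, i) entry of the composite writes the identity of U(A i) as a sum of morphisms through
    -- U(k); one of the two inverse relations is enough.
    obtain ⟨t, ht, hsum⟩ := hfg i i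
    exact (NCMotive.brauerClass_eq_baseCSA_iff (A i)).2 ⟨r, hr.out,
      NCMotive.nonempty_matrix_algEquiv e (NCMotive.finrank_eq_one_of_isComp e b (J := Fin n)
        (fun j => f i j) (fun j => g j i) t ht (hε.1 i) hsum)⟩
  · intro h
    refine NCMotive.Motive.isomorphic_sumU fun i => ?_
    obtain ⟨r, hr, ⟨e⟩⟩ := (NCMotive.brauerClass_eq_baseCSA_iff (A i)).1 (h i)
    have := NeZero.mk hr
    exact NCMotive.exists_inverse_of_matrix e b
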